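/- **Setting.** Let $\Lambda(x,y)={}^t x J y$, $J=\begin{pmatrix}0&I_2\\-I_2&0\end{pmatrix}$, be the standard symplectic form on $\mathbb R^4$, and let $\mathcal S(4,\mathbb R)=\left\{\begin{pmatrix}1&0\\a&A\end{pmatrix}: a\in\mathbb R^4,\ {}^tAJA=J\right\}$ be the 14-dimensional affine symplectic group, acting on $\mathbb R^4$ by $x\mapsto Ax+a$. A point of the jet space $J^k=J^k(\mathbb R,\mathbb R^4)$ is $z=(t,X^{(0)},\dots,X^{(k)})$, with coordinates $x^{(i)}_a$; the prolonged action is $g\star z=(t,AX^{(0)}+a,AX^{(1)},\dots,AX^{(k)})$, i.e. multiplication of the matrix $\mathbb X(z)=\begin{pmatrix}1&0&\cdots&0\\X^{(0)}&X^{(1)}&\cdots&X^{(k)}\end{pmatrix}$ by $g$. Put $\kappa_i=\Lambda(X^{(i)},X^{(i+1)})$ (the symplectic curvatures) and $\phi=\det(X^{(1)},X^{(2)},X^{(3)},X^{(4)})$. A prime on a function on jet space is the total derivative, and along a curve the ordinary derivative. One has $\phi=\kappa_2^2-\kappa_1\kappa_3+\kappa_1'\kappa_2'-\kappa_2\kappa_1''$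 on $J^4$. Let $\mathcal U\subset J^4$ be the open set $\kappa_2\phi\ne0$. Let $V_1,\dots,V_{14}$ be the prolonged infinitesimal generators of the action for the basis $T_1,\dots,T_4,A_1^1,A_2^2,A_1^2,A_2^1,B_1^1,B_2^2,B_1^2,C_1^1,C_2^2,C_1^2$ of the Lie algebra $\mathfrak s(4,\mathbb R)$, where $T_a$ is the $a$-th translation and the linear parts of the others are $A_i^j=\begin{pmatrix}E_{ij}&0\\0&-E_{ji}\end{pmatrix}$, $B_i^i=\begin{pmatrix}0&E_{ii}\\0&0\end{pmatrix}$, $B_1^2=\begin{pmatrix}0&E_{12}+E_{21}\\0&0\end{pmatrix}$, $C_i^j={}^tB_i^j$. A submanifold of $J^k$ is a cross-section if at each of its points its tangent space is complementary to the tangent space of the orbit through that point. **1. Cross-section.** Let $P=(p_1,\dots,p_{14})$ be the left-hand sides, in this order, of $$x^{(0)}_1=x^{(0)}_2=x^{(0)}_3=x^{(0)}_4=0,\quad x^{(1)}_1=1,\ x^{(1)}_2=x^{(1)}_3=x^{(1)}_4=0,\quad x^{(2)}_1=0,\ x^{(2)}_2=1,\ x^{(2)}_4=0,\quad x^{(3)}_1=x^{(3)}_2=0,\quad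 x^{(4)}_1=0,$$ and $\mathcal P\subset J^4$ the submanifold, of codimension 14, that these equations define. On $\mathcal P$, $$-\det\big(V_i(p_j)\big)=\big(x^{(3)}_4x^{(4)}_2x^{(2)}_3+x^{(4)}_4x^{(3)}_3-x^{(3)}_4x^{(4)}_3\big)x^{(3)}_4=\kappa_2\phi,$$ and $\mathcal P$ is transverse to the orbits (tangent spaces complementary) at exactly those of its points where this does not vanish. The manifold $\mathcal K=\mathcal P\cap\mathcal U$ is a cross-section of minimal order: for every $k\le4$ its projection to $J^k$ is a cross-section to the orbits on $J^k$. If $\gamma:I\to\mathbb R^4$ is a Lagrangian curve ($I$ an open interval, $\gamma$ smooth, $\gamma',\gamma''$ independent, $\Lambda(\gamma',\gamma'')=0$), then its 4-jets $j^4\gamma(t)$ lie in $\mathcal U$ for all $t\in I$ if and only if $\gamma$ is linearly full ($\gamma',\gamma'',\gamma''',\gamma''''$ independent at every $t\in I$), and if and only if $\Lambda(\gamma'',\gamma''')$ vanishes nowhere on $I$. **2. Moving frame.** There is a smooth map $\rho:\mathcal U\to\mathcal S(4,\mathbb R)$ with $\rho(z)\star z\in\mathcal K$ and $\rho(g\star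 z)=\rho(z)g^{-1}$ for all $z\in\mathcal U$, $g\in\mathcal S(4,\mathbb R)$ (the set $\mathcal U$ is invariant); $\rho(z)$ is the only $g\in\mathcal S(4,\mathbb R)$ with $g\star z\in\mathcal K$, and $\rho=1$ on $\mathcal K$. Write $\bar\iota z=\rho(z)\star z$, with coordinates $\bar\iota x^{(i)}_a$ (also for jets of order 5, $\rho$ being evaluated on the underlying 4-jet). Then on $\mathcal U$ $$\begin{pmatrix}\bar\iota X^{(0)}&\bar\iota X^{(1)}&\bar\iota X^{(2)}&\bar\iota X^{(3)}&\bar\iota X^{(4)}\end{pmatrix}=\begin{pmatrix}0&1&0&0&0\\0&0&1&0&-\frac{\kappa_3}{\kappa_2}\\0&0&\kappa_1&\kappa_1'&\kappa_1''-\kappa_2\\0&0&0&\kappa_2&\kappa_2'\end{pmatrix},$$ and $\rho(z)=\mathbb X(\bar\iota z)\,\mathbb X(z)^{-1}$. In particular $\kappa_1=\bar\iota x^{(2)}_3$, $\kappa_2=\bar\iota x^{(3)}_4$, $\kappa_3=-\bar\iota x^{(3)}_4\,\bar\iota x^{(4)}_2$; moreover $\det(V_i(p_j))$ at $\bar\iota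 z$ equals $-\kappa_2\phi$ at $z$. On the part of $J^5$ over $\mathcal U$ put $$\tau=\frac{\bar\iota x^{(3)}_4\,\bar\iota x^{(5)}_1}{\phi}=\frac{\kappa_2^2}{\phi^2}\kappa_4-\frac{\kappa_2\kappa_2'}{\phi^2}\kappa_3'+\frac{\kappa_2\kappa_3}{\phi^2}\kappa_2''-\frac{\kappa_2\kappa_3^2}{\phi^2}$$ (the second equality being part of the assertion). Then, for the right Maurer–Cartan form $\Omega=dg\,g^{-1}$ and modulo the contact forms $dX^{(i)}-X^{(i+1)}dt$ ($0\le i\le4$), one has $\rho^*\Omega\equiv-M\,dt$ with $$M=\begin{pmatrix}0&0&0&0&0\\1&0&\kappa_1\tau&-\tau&\frac{\kappa_1'\tau}{\kappa_2}\\0&1&-\frac{\kappa_1\kappa_1'\tau}{\kappa_2}&\frac{\kappa_1'\tau}{\kappa_2}&-\frac{\kappa_1'^2\tau+\kappa_3}{\kappa_2^2}\\0&\kappa_1&0&0&-1\\0&0&\kappa_2+\kappa_1^2\tau&-\kappa_1\tau&\frac{\kappa_1\kappa_1'\tau}{\kappa_2}\end{pmatrix}.$$ Along any smooth curve $\gamma:I\to\mathbb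 R^4$ ($I$ an open interval) whose 4-jets lie in $\mathcal U$, both formulas hold with $\kappa_i$ replaced by the functions $\bar\kappa_i=\kappa_i\circ j^{i+1}\gamma$ of $t$ and primes by $d/dt$; the second then reads $R'=-MR$ for $R=\rho\circ j^4\gamma$. **3. Congruence.** Let $I$ be an open interval and $\gamma_1,\gamma_2:I\to\mathbb R^4$ smooth curves, $\kappa_2$ and $\phi$ vanishing nowhere along $\gamma_1$. There is $g\in\mathcal S(4,\mathbb R)$ with $\gamma_2=g\star\gamma_1$ on $I$ if and only if $\gamma_1$ and $\gamma_2$ have the same symplectic curvatures $\bar\kappa_1,\dots,\bar\kappa_4$ as functions on $I$. **4. Realization.** Let $I$ be an open interval and $\bar\kappa_1,\dots,\bar\kappa_4:I\to\mathbb R$ smooth functions such that $\bar\kappa_2$ and $\bar\phi=\bar\kappa_2^2-\bar\kappa_1\bar\kappa_3+\bar\kappa_1'\bar\kappa_2'-\bar\kappa_2\bar\kappa_1''$ vanish nowhere. Then the curve $\bar\gamma:I\to J^4$, whose first component is $t$ and whose other components are given by the first displayed matrix of part 2, lies in $\mathcal K$; there is $\bar\rho:I\to\mathcal S(4,\mathbb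 R)$ with $\bar\rho'=-\bar M\bar\rho$, where $\bar M$ is the matrix $M$ formed with $\bar\kappa_1,\dots,\bar\kappa_4$ (and $\bar\phi$ in $\tau$); any two such maps $\bar\rho_1,\bar\rho_2$ satisfy $\bar\rho_2=\bar\rho_1g$ for a constant $g\in\mathcal S(4,\mathbb R)$; and for each such $\bar\rho$, $\bar\rho^{-1}\star\bar\gamma$ is the 4-jet of a smooth curve $\gamma:I\to\mathbb R^4$ whose symplectic curvatures are $\bar\kappa_1,\dots,\bar\kappa_4$. -/

import Mathlib

open Set Matrix
open scoped ContDiff Topology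

noncomputable section

/-! ### The affine symplectic group of ℝ⁴ -/

/-- The matrix `J` of the standard symplectic form. -/
def sympJ : Matrix (Fin 4) (Fin 4) ℝ :=
  !![0, 0, 1, 0; 0, 0, 0, 1; -1, 0, 0, 0; 0, -1, 0, 0]

/-- The standard symplectic form `Λ(x, y) = ᵗx J y`. -/
def sympForm (x y : Fin 4 → ℝ) : ℝ := x ⬝ᵥ (sympJ *ᵥ y)

/-- The linear part of a `5 × 5` matrix: its lower right `4 × 4` block. -/
def linPart (g : Matrix (Fin 5) (Fin 5) ℝ) : Matrix (Fin 4) (Fin 4) ℝ :=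
  g.submatrix Fin.succ Fin.succ

/-- The affine symplectic group `𝒮(4, ℝ)`: the matrices with first row `(1, 0, 0, 0, 0)`
and symplectic linear part. -/
def affSp : Set (Matrix (Fin 5) (Fin 5) ℝ) :=
  {g | g 0 = Pi.single 0 1 ∧ (linPart g)ᵀ * sympJ * linPart g = sympJ}

/-- The affine action of a matrix on a point of ℝ⁴: `(1, x) ↦ g (1, x)`. -/
def affAct (g : Matrix (Fin 5) (Fin 5) ℝ) (x : Fin 4 → ℝ) : Fin 4 → ℝ :=
  fun a => (g *ᵥ (Fin.cons 1 x : Fin 5 → ℝ)) a.succ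

/-- The basis `T₁, …, T₄, A₁¹, A₂², A₁², A₂¹, B₁¹, B₂², B₁², C₁¹, C₂², C₁²` of the Lie algebra
of `𝒮(4, ℝ)`. -/
def lieBasis : Fin 14 → Matrix (Fin 5) (Fin 5) ℝ :=
  ![single 1 0 1, single 2 0 1, single 3 0 1, single 4 0 1,
    single 1 1 1 - single 3 3 1, single 2 2 1 - single 4 4 1,
    single 1 2 1 - single 4 3 1, single 2 1 1 - single 3 4 1,
    single 1 3 1, single 2 4 1, single 1 4 1 + single 2 3 1,
    single 3 1 1, single 4 2 1, single 3 2 1 + single 4 1 1]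

/-! ### Jets of parameterized curves in ℝ⁴ -/

/-- The jet space `J^k(ℝ, ℝ⁴)`: a point is `(t, (X⁽⁰⁾, …, X⁽ᵏ⁾))`.  For `z : Jet k`, the coordinate
with jet order `i` and component `a ∈ {1, 2, 3, 4}` is `z.2 i (a - 1)`. -/
abbrev Jet (k : ℕ) : Type := ℝ × (Fin (k + 1) → Fin 4 → ℝ)

/-- The canonical projection `J^k → J^m`, for `m ≤ k`. -/
def trunc {k : ℕ} (m : ℕ) (z : Jet k) (h : m ≤ k := by omega) : Jet m :=
  (z.1, fun i => z.2 (Fin.castLE (Nat.succ_le_succ h) i))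

/-- The `k`-jet at `t` of a curve. -/
def jet (k : ℕ) (γ : ℝ → Fin 4 → ℝ) (t : ℝ) : Jet k := (t, fun i => iteratedDeriv i γ t)

/-- The `5 × (k+1)` matrix with first row `(1, 0, …, 0)` and columns `X⁽⁰⁾, …, X⁽ᵏ⁾` below it. -/
def jetMatrix {k : ℕ} (z : Jet k) : Matrix (Fin 5) (Fin (k + 1)) ℝ :=
  Matrix.of (Fin.cons (Pi.single 0 1) (fun a i => z.2 i a) : Fin 5 → Fin (k + 1) → ℝ)

/-- The prolonged action of the group on `J^k`: multiplication of the jet matrix, `t` being fixed. -/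
def act {k : ℕ} (g : Matrix (Fin 5) (Fin 5) ℝ) (z : Jet k) : Jet k :=
  (z.1, fun i a => (g * jetMatrix z) a.succ i)

/-- The value at `z` of the prolonged infinitesimal generator given by the Lie algebra element `𝔞`,
i.e. the derivative at the identity of `g ↦ g ⋆ z` in the direction `𝔞`. -/
def infGen {k : ℕ} (𝔞 : Matrix (Fin 5) (Fin 5) ℝ) (z : Jet k) : Jet k :=
  (0, fun i a => (𝔞 * jetMatrix z) a.succ i)

/-- The tangent space at `z` of the orbit of `z` in `J^k`. -/
def orbitTangent {k : ℕ} (z : Jet k) : Submodule ℝ (Jet k) :=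
  Submodule.span ℝ (range fun i => infGen (lieBasis i) z)

/-- The total derivative `D f = ∂f/∂t + ∑ᵢ X⁽ⁱ⁺¹⁾ · ∂f/∂X⁽ⁱ⁾` of a function on `J^k`,
a function on `J^(k+1)`. -/
def totalDeriv {k : ℕ} (f : Jet k → ℝ) (z : Jet (k + 1)) : ℝ :=
  fderiv ℝ f (trunc k z) (1, fun i => z.2 i.succ)

/-- A tangent vector `v` at `z ∈ J^k` is annihilated by the contact forms
`dX⁽ⁱ⁾ - X⁽ⁱ⁺¹⁾ dt`, `0 ≤ i < k`. -/
def IsContactVector {k : ℕ} (z v : Jet k) : Prop :=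
  ∀ i : Fin k, v.2 i.castSucc = v.1 • z.2 i.succ

/-! ### Differential invariants -/

/-- The symplectic curvature `κᵢ = Λ(X⁽ⁱ⁾, X⁽ⁱ⁺¹⁾)`. -/
def curv (i : ℕ) (z : Jet (i + 1)) : ℝ :=
  sympForm (z.2 (Fin.castSucc (Fin.last i))) (z.2 (Fin.last (i + 1)))

/-- `φ = det(X⁽¹⁾, X⁽²⁾, X⁽³⁾, X⁽⁴⁾)`. -/
def phi (z : Jet 4) : ℝ := Matrix.det (Matrix.of fun a c : Fin 4 => z.2 c.succ a)

/-- The symplectic curvature `κᵢ` along a curve. -/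
def curveCurv (i : ℕ) (γ : ℝ → Fin 4 → ℝ) (t : ℝ) : ℝ := curv i (jet (i + 1) γ t)

/-! ### Cross-sections -/

/-- Near its point `z`, the set `S ⊆ J^k` is a cross-section: an embedded submanifold (the zero set
of a smooth submersion) whose tangent spaces are complementary to those of the orbits. -/
def IsLocalCrossSectionAt {k : ℕ} (S : Set (Jet k)) (z : Jet k) : Prop :=
  z ∈ S ∧ ∃ (r : ℕ) (F : Jet k → Fin r → ℝ) (U : Set (Jet k)),
    IsOpen U ∧ z ∈ U ∧ ContDiffOn ℝ ∞ F U ∧ S ∩ U = {w ∈ U | F w = 0} ∧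
    ∀ w ∈ S ∩ U, Function.Surjective (fderiv ℝ F w) ∧
      IsCompl (LinearMap.ker (fderiv ℝ F w).toLinearMap) (orbitTangent w)

/-- A set `S ⊆ J^n` is a cross-section of minimal order: for every `k ≤ n` its projection to `J^k`
is a cross-section to the orbits on `J^k` (for `k = n` this says that `S` itself is one). -/
def IsMinimalOrderCrossSection {n : ℕ} (S : Set (Jet n)) : Prop :=
  ∀ (k : ℕ) (hk : k ≤ n), ∀ z ∈ (fun w : Jet n => trunc k w hk) '' S,
    IsLocalCrossSectionAt ((fun w : Jet n => trunc k w hk) '' S) z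

/-- The left-hand sides of the 14 equations. -/
def secMap (z : Jet 4) : Fin 14 → ℝ :=
  ![z.2 0 0, z.2 0 1, z.2 0 2, z.2 0 3,
    z.2 1 0, z.2 1 1, z.2 1 2, z.2 1 3,
    z.2 2 0, z.2 2 1, z.2 2 3,
    z.2 3 0, z.2 3 1,
    z.2 4 0]

/-- The right-hand sides of the 14 equations. -/
def secVal : Fin 14 → ℝ := ![0, 0, 0, 0, 1, 0, 0, 0, 0, 1, 0, 0, 0, 0]

/-- The subset of `J⁴` defined by the 14 equations. -/
def secVariety : Set (Jet 4) := {z | secMap z = secVal}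

/-- The polynomial whose zeros on `secVariety` are to be excluded. -/
def excluded (z : Jet 4) : ℝ :=
  (z.2 3 3 * z.2 4 1 * z.2 2 2 + z.2 4 3 * z.2 3 2 - z.2 3 3 * z.2 4 2) * z.2 3 3

/-- The matrix `V(P) = (Vᵢ(pⱼ))`. -/
def transMatrix (z : Jet 4) : Matrix (Fin 14) (Fin 14) ℝ :=
  Matrix.of fun i j => fderiv ℝ secMap z (infGen (lieBasis i) z) j

/-- The open set `κ₂ φ ≠ 0` of `J⁴`. -/
def regJets : Set (Jet 4) := {z | curv 2 (trunc 3 z) * phi z ≠ 0}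

/-- The cross-section: the part of `secVariety` where `κ₂ φ ≠ 0`. -/
def crossSec : Set (Jet 4) := secVariety ∩ regJets

/-! ### The explicit formulas

In the four definitions below `dk` and `ddk` stand for the first and second derivatives of `k`. -/

/-- `φ` in terms of the symplectic curvatures. -/
def phiVal (k1 dk1 ddk1 k2 dk2 k3 : ℝ) : ℝ := k2 ^ 2 - k1 * k3 + dk1 * dk2 - k2 * ddk1

/-- The fifth order invariant `τ`. -/
def tauVal (k2 dk2 ddk2 k3 dk3 k4 φ : ℝ) : ℝ :=
  k2 ^ 2 / φ ^ 2 * k4 - k2 * dk2 / φ ^ 2 * dk3 + k2 * k3 / φ ^ 2 * ddk2 - k2 * k3 ^ 2 / φ ^ 2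

/-- The Serret–Frenet matrix `M` (the Maurer–Cartan matrix is `-M dt`). -/
def frenetVal (k1 dk1 k2 k3 τ : ℝ) : Matrix (Fin 5) (Fin 5) ℝ :=
  !![0, 0, 0, 0, 0;
     1, 0, k1 * τ, -τ, dk1 * τ / k2;
     0, 1, -(k1 * dk1 * τ / k2), dk1 * τ / k2, -((dk1 ^ 2 * τ + k3) / k2 ^ 2);
     0, k1, 0, 0, -1;
     0, 0, k2 + k1 ^ 2 * τ, -(k1 * τ), k1 * dk1 * τ / k2]

/-- The matrix of the normalized invariants of order at most four. -/
def normVal (k1 dk1 ddk1 k2 dk2 k3 : ℝ) : Matrix (Fin 4) (Fin 5) ℝ :=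
  !![0, 1, 0, 0, 0;
     0, 0, 1, 0, -(k3 / k2);
     0, 0, k1, dk1, ddk1 - k2;
     0, 0, 0, k2, dk2]

/-! The same expressions as functions on jet spaces, with total derivatives. -/

/-- The expression of `φ` on `J⁴`. -/
def phiJet (z : Jet 4) : ℝ :=
  phiVal (curv 1 (trunc 2 z)) (totalDeriv (curv 1) (trunc 3 z)) (totalDeriv (totalDeriv (curv 1)) z)
    (curv 2 (trunc 3 z)) (totalDeriv (curv 2) z) (curv 3 z)

/-- The expression of `τ` on `J⁵`. -/
def tauJet (z : Jet 5) : ℝ :=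
  tauVal (curv 2 (trunc 3 z)) (totalDeriv (curv 2) (trunc 4 z)) (totalDeriv (totalDeriv (curv 2)) z)
    (curv 3 (trunc 4 z)) (totalDeriv (curv 3) z) (curv 4 z) (phi (trunc 4 z))

/-- The Serret–Frenet matrix on `J⁵`. -/
def frenetJet (z : Jet 5) : Matrix (Fin 5) (Fin 5) ℝ :=
  frenetVal (curv 1 (trunc 2 z)) (totalDeriv (curv 1) (trunc 3 z))
    (curv 2 (trunc 3 z)) (curv 3 (trunc 4 z)) (tauJet z)

/-- The point of `J⁴` whose coordinates are the normalized invariants of `z`. -/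
def normJet (z : Jet 4) : Jet 4 :=
  (z.1, (normVal (curv 1 (trunc 2 z)) (totalDeriv (curv 1) (trunc 3 z))
    (totalDeriv (totalDeriv (curv 1)) z) (curv 2 (trunc 3 z)) (totalDeriv (curv 2) z) (curv 3 z))ᵀ)

/-! The same expressions for given functions `k₁, …, k₄` of one variable. -/

/-- The function `φ` defined by `k₁, k₂, k₃`. -/
def phiOf (k1 k2 k3 : ℝ → ℝ) (t : ℝ) : ℝ :=
  phiVal (k1 t) (deriv k1 t) (deriv (deriv k1) t) (k2 t) (deriv k2 t) (k3 t)

/-- The function `τ` defined by `k₁, …, k₄`. -/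
def tauOf (k1 k2 k3 k4 : ℝ → ℝ) (t : ℝ) : ℝ :=
  tauVal (k2 t) (deriv k2 t) (deriv (deriv k2) t) (k3 t) (deriv k3 t) (k4 t) (phiOf k1 k2 k3 t)

/-- The Serret–Frenet matrix defined by `k₁, …, k₄`. -/
def frenetOf (k1 k2 k3 k4 : ℝ → ℝ) (t : ℝ) : Matrix (Fin 5) (Fin 5) ℝ :=
  frenetVal (k1 t) (deriv k1 t) (k2 t) (k3 t) (tauOf k1 k2 k3 k4 t)

/-- The curve in the cross-section defined by `k₁, k₂, k₃`. -/
def normOf (k1 k2 k3 : ℝ → ℝ) (t : ℝ) : Jet 4 :=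
  (t, (normVal (k1 t) (deriv k1 t) (deriv (deriv k1) t) (k2 t) (deriv k2 t) (k3 t))ᵀ)

/-! ### Moving frames and curves -/

/-- A (right) moving frame on the invariant open set `κ₂ φ ≠ 0` of `J⁴` attached to `crossSec`:
a smooth `𝒮(4, ℝ)`-valued map that brings every jet into the cross-section and satisfies
`ρ(g ⋆ z) = ρ(z) g⁻¹`. -/
def IsMovingFrame (ρ : Jet 4 → Matrix (Fin 5) (Fin 5) ℝ) : Prop :=
  (∀ i j, ContDiffOn ℝ ∞ (fun z => ρ z i j) regJets) ∧
  ∀ z ∈ regJets, ρ z ∈ affSp ∧ act (ρ z) z ∈ crossSec ∧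
    ∀ g ∈ affSp, act g z ∈ regJets ∧ ρ (act g z) = ρ z * g⁻¹

/-- The pullback to `J⁵` of the right Maurer–Cartan form `dg · g⁻¹` by a map `ρ` on `J⁴`,
evaluated at `z` on the tangent vector `v`. -/
def pullbackMC (ρ : Jet 4 → Matrix (Fin 5) (Fin 5) ℝ) (z v : Jet 5) : Matrix (Fin 5) (Fin 5) ℝ :=
  (Matrix.of fun i j => fderiv ℝ (fun w : Jet 5 => ρ (trunc 4 w) i j) z v) * (ρ (trunc 4 z))⁻¹

/-- On `I`, the map `R` takes its values in `𝒮(4, ℝ)` and the pullback by `R` of the right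
Maurer–Cartan form is `-M(t) dt`, i.e. `R' = -M R`. -/
def HasMCForm (I : Set ℝ) (M R : ℝ → Matrix (Fin 5) (Fin 5) ℝ) : Prop :=
  ∀ t ∈ I, R t ∈ affSp ∧ ∀ i j, HasDerivAt (fun s => R s i j) ((-(M t) * R t) i j) t

/-- Lagrangian curves. -/
def IsLagrangian (I : Set ℝ) (γ : ℝ → Fin 4 → ℝ) : Prop :=
  ContDiffOn ℝ ∞ γ I ∧ ∀ t ∈ I,
    LinearIndependent ℝ ![iteratedDeriv 1 γ t, iteratedDeriv 2 γ t] ∧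
    sympForm (iteratedDeriv 1 γ t) (iteratedDeriv 2 γ t) = 0

/-- Linearly full curves. -/
def IsLinearlyFull (I : Set ℝ) (γ : ℝ → Fin 4 → ℝ) : Prop :=
  ∀ t ∈ I, LinearIndependent ℝ
    ![iteratedDeriv 1 γ t, iteratedDeriv 2 γ t, iteratedDeriv 3 γ t, iteratedDeriv 4 γ t]

end

noncomputable section

/-! ### The symplectic form and the total derivative of its values -/

/-! The group acts on jets by multiplying `jetMatrix z`, which on `J⁴` is square with determinant φ.
If φ ≠ 0 at a jet, at most one matrix carries it to another jet with the same t, and the quotient of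
the two jet matrices is affine symplectic as soon as the products Λ(X⁽ⁱ⁾, X⁽ʲ⁾), 1 ≤ i, j ≤ 4, of
the two jets agree (`mul_inv_mem_affSp`). By the Leibniz rule and antisymmetry the six independent
products are κ₁, κ₁', κ₁'' - κ₂, κ₂, κ₂', κ₃, and -φ is the Pfaffian they form. `normJet z` is the
point of the section with the same products as `z`. It is constant on orbits and fixes the section
pointwise, so `frame`, the quotient of the jet matrices of `normJet z` and `z`, is a moving frame
and the only possible one.

Let X and N be the jet matrices of `z` and `normJet z`, and R the frame. Differentiating R X = N in
a contact direction with dt-component 1 gives R' R⁻¹ N = N' - S, where S holds the normalized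
derivatives of orders one to five. Only the last column of S is new. Its products with the
normalized derivatives of orders one to four are invariants already known, and they determine it,
with first coordinate τφ/κ₂ (`eq_normNext`). The Serret–Frenet equation is thereby reduced to the
matrix identity M N = S - N' (`frenetVal_mul_normVal`).

For congruence, equal curvatures give equal M and N. The two frames solve the same linear equation
R' = -M R, hence differ by a constant right factor, and this factor carries one curve to the other.
Realization reads the identity backwards: a solution R stays in the group because M lies in its Lie
algebra, and (R⁻¹ N)' = R⁻¹ S says that the columns of R⁻¹ N are the successive derivatives of the
first one.

Transversality is linear algebra: the fourteen equations fix coordinates, so complementarity of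
tangent spaces means invertibility of the matrix of these coordinates on the fourteen generators
(`isCompl_iff_excluded_ne_zero`). -/

theorem sympForm_apply (x y : Fin 4 → ℝ) :
    sympForm x y = x 0 * y 2 + x 1 * y 3 - x 2 * y 0 - x 3 * y 1 := by
  simp [sympForm, sympJ, dotProduct, mulVec, Fin.sum_univ_four]
  ring

theorem sympForm_self (x : Fin 4 → ℝ) : sympForm x x = 0 := by
  rw [sympForm_apply]; ring

theorem HasDerivAt.sympForm {x y : ℝ → Fin 4 → ℝ} {x' y' : Fin 4 → ℝ} {t : ℝ}
    (hx : HasDerivAt x x' t) (hy : HasDerivAt y y' t) :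
    HasDerivAt (fun s => sympForm (x s) (y s)) (sympForm x' (y t) + sympForm (x t) y') t := by
  have hx' := hasDerivAt_pi.1 hx
  have hy' := hasDerivAt_pi.1 hy
  simp only [sympForm_apply]
  refine ((((hx' 0).mul (hy' 2)).add ((hx' 1).mul (hy' 3))).sub ((hx' 2).mul (hy' 0))).sub
    ((hx' 3).mul (hy' 1)) |>.congr_deriv ?_
  ring

theorem contDiff_coord {k : ℕ} (i : Fin (k + 1)) (a : Fin 4) {n : WithTop ℕ∞} :
    ContDiff ℝ n (fun z : Jet k => z.2 i a) := by
  fun_prop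

theorem contDiff_sympForm {k : ℕ} (i j : Fin (k + 1)) {n : WithTop ℕ∞} :
    ContDiff ℝ n (fun z : Jet k => sympForm (z.2 i) (z.2 j)) := by
  simp only [sympForm_apply]
  fun_prop

theorem fderiv_sympForm {k : ℕ} (i j : Fin (k + 1)) (z v : Jet k) :
    fderiv ℝ (fun z : Jet k => sympForm (z.2 i) (z.2 j)) z v =
      sympForm (v.2 i) (z.2 j) + sympForm (z.2 i) (v.2 j) := by
  have hd : DifferentiableAt ℝ (fun z : Jet k => sympForm (z.2 i) (z.2 j)) z :=
    (contDiff_sympForm i j (n := 1)).differentiable (by simp) z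
  rw [← hd.lineDeriv_eq_fderiv, lineDeriv]
  have h : ∀ i : Fin (k + 1), HasDerivAt (fun s : ℝ => (z + s • v).2 i) (v.2 i) 0 := fun i => by
    have := ((hasDerivAt_id (0 : ℝ)).smul_const (v.2 i)).const_add (z.2 i)
    simpa using this
  have := (h i).sympForm (h j)
  simpa using this.deriv

theorem totalDeriv_sympForm {k : ℕ} (i j : Fin (k + 1)) :
    totalDeriv (fun z : Jet k => sympForm (z.2 i) (z.2 j)) = fun z =>
      sympForm (z.2 i.succ) (z.2 j.castSucc) + sympForm (z.2 i.castSucc) (z.2 j.succ) := by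
  funext z
  exact fderiv_sympForm i j _ _

/-- In D Λ(X⁽ⁱ⁾, X⁽ⁱ⁺¹⁾) the term Λ(X⁽ⁱ⁺¹⁾, X⁽ⁱ⁺¹⁾) vanishes by antisymmetry. All derived invariants
thus become combinations of products Λ(X⁽ⁱ⁾, X⁽ʲ⁾) with i, j ≥ 1, and in that form their invariance
is visible. -/
theorem totalDeriv_curv_one :
    totalDeriv (curv 1) = fun z : Jet 3 => sympForm (z.2 1) (z.2 3) := by
  refine (totalDeriv_sympForm (k := 2) 1 2).trans ?_
  funext z
  exact (congrArg (· + _) (sympForm_self _)).trans (zero_add _)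

theorem totalDeriv_curv_two :
    totalDeriv (curv 2) = fun z : Jet 4 => sympForm (z.2 2) (z.2 4) := by
  refine (totalDeriv_sympForm (k := 3) 2 3).trans ?_
  funext z
  exact (congrArg (· + _) (sympForm_self _)).trans (zero_add _)

theorem totalDeriv_curv_three :
    totalDeriv (curv 3) = fun z : Jet 5 => sympForm (z.2 3) (z.2 5) := by
  refine (totalDeriv_sympForm (k := 4) 3 4).trans ?_
  funext z
  exact (congrArg (· + _) (sympForm_self _)).trans (zero_add _)

theorem totalDeriv_totalDeriv_curv_one :
    totalDeriv (totalDeriv (curv 1)) =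
      fun z : Jet 4 => sympForm (z.2 2) (z.2 3) + sympForm (z.2 1) (z.2 4) := by
  rw [totalDeriv_curv_one]
  exact totalDeriv_sympForm (k := 3) 1 3

theorem totalDeriv_totalDeriv_curv_two :
    totalDeriv (totalDeriv (curv 2)) =
      fun z : Jet 5 => sympForm (z.2 3) (z.2 4) + sympForm (z.2 2) (z.2 5) := by
  rw [totalDeriv_curv_two]
  exact totalDeriv_sympForm (k := 4) 2 4

theorem normJet_eq (z : Jet 4) :
    normJet z = ((z.1, (normVal (sympForm (z.2 1) (z.2 2)) (sympForm (z.2 1) (z.2 3))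
      (sympForm (z.2 2) (z.2 3) + sympForm (z.2 1) (z.2 4)) (sympForm (z.2 2) (z.2 3))
      (sympForm (z.2 2) (z.2 4)) (sympForm (z.2 3) (z.2 4)))ᵀ) : Jet 4) := by
  rw [normJet, totalDeriv_totalDeriv_curv_one, totalDeriv_curv_one, totalDeriv_curv_two]
  rfl

theorem phiJet_eq (z : Jet 4) :
    phiJet z = phiVal (sympForm (z.2 1) (z.2 2)) (sympForm (z.2 1) (z.2 3))
      (sympForm (z.2 2) (z.2 3) + sympForm (z.2 1) (z.2 4)) (sympForm (z.2 2) (z.2 3))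
      (sympForm (z.2 2) (z.2 4)) (sympForm (z.2 3) (z.2 4)) := by
  rw [phiJet, totalDeriv_totalDeriv_curv_one, totalDeriv_curv_one, totalDeriv_curv_two]
  rfl

theorem tauJet_eq (z : Jet 5) :
    tauJet z = tauVal (sympForm (z.2 2) (z.2 3)) (sympForm (z.2 2) (z.2 4))
      (sympForm (z.2 3) (z.2 4) + sympForm (z.2 2) (z.2 5)) (sympForm (z.2 3) (z.2 4))
      (sympForm (z.2 3) (z.2 5)) (sympForm (z.2 4) (z.2 5)) (phi (trunc 4 z)) := by
  rw [tauJet, totalDeriv_totalDeriv_curv_two, totalDeriv_curv_two, totalDeriv_curv_three]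
  rfl

theorem frenetJet_eq (z : Jet 5) :
    frenetJet z = frenetVal (sympForm (z.2 1) (z.2 2)) (sympForm (z.2 1) (z.2 3))
      (sympForm (z.2 2) (z.2 3)) (sympForm (z.2 3) (z.2 4)) (tauJet z) := by
  rw [frenetJet, totalDeriv_curv_one]
  rfl

/-- Since det J = 1, the Gram determinant of X⁽¹⁾, …, X⁽⁴⁾ is φ², so φ is up to sign the Pfaffian
Λ₁₂Λ₃₄ - Λ₁₃Λ₂₄ + Λ₁₄Λ₂₃, where Λ₁₄ = κ₁'' - κ₂. The sign is minus. -/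
theorem phi_eq_phiJet (z : Jet 4) : phi z = phiJet z := by
  rw [phiJet_eq]
  simp only [phi, phiVal, sympForm_apply]
  rw [Matrix.det_succ_row_zero]
  simp [Fin.sum_univ_succ, Matrix.det_fin_three, Fin.succAbove]
  ring

theorem mem_regJets {z : Jet 4} :
    z ∈ regJets ↔ sympForm (z.2 2) (z.2 3) ≠ 0 ∧ phi z ≠ 0 :=
  mul_ne_zero_iff

/-! ### Linear systems of ordinary differential equations -/

/-- The coordinatewise truncation of a vector to `[-B, B]`. -/
def clampVec {ι : Type*} {B : ℝ} (hB : -B ≤ B) (x : ι → ℝ) : ι → ℝ :=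
  fun i => (projIcc (-B) B hB (x i) : ℝ)

theorem lipschitzWith_clampVec {ι : Type*} [Fintype ι] {B : ℝ} (hB : -B ≤ B) :
    LipschitzWith 1 (clampVec (ι := ι) hB) := by
  refine LipschitzWith.of_dist_le_mul fun x y => ?_
  rw [NNReal.coe_one, one_mul]
  refine (dist_pi_le_iff dist_nonneg).2 fun i => ?_
  have := (LipschitzWith.projIcc hB).dist_le_mul (x i) (y i)
  rw [NNReal.coe_one, one_mul] at this
  exact this.trans (dist_le_pi_dist x y i)

theorem clampVec_of_norm_le {ι : Type*} [Fintype ι] {B : ℝ} (hB : -B ≤ B) {x : ι → ℝ}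
    (hx : ‖x‖ ≤ B) : clampVec hB x = x := by
  funext i
  have := abs_le.1 ((norm_le_pi_norm x i).trans hx)
  exact congrArg Subtype.val (projIcc_of_mem hB this)

theorem norm_clampVec_le_norm {ι : Type*} [Fintype ι] {B : ℝ} (hB : -B ≤ B) (x : ι → ℝ) :
    ‖clampVec hB x‖ ≤ ‖x‖ := by
  have h0 : clampVec hB (0 : ι → ℝ) = 0 := clampVec_of_norm_le hB (by simp; linarith)
  simpa [h0] using (lipschitzWith_clampVec hB).dist_le_mul x 0

theorem norm_clampVec_le {ι : Type*} [Fintype ι] {B : ℝ} (hB : -B ≤ B) (x : ι → ℝ) :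
    ‖clampVec hB x‖ ≤ B := by
  refine (pi_norm_le_iff_of_nonneg (by linarith)).2 fun i => abs_le.2 ?_
  exact (projIcc (-B) B hB (x i)).2

/-- A solution of `α' = f(t, α)` with `‖f(t, x)‖ ≤ K ‖x‖` is bounded on compact intervals. -/
theorem norm_le_of_norm_deriv_le {E : Type*} [NormedAddCommGroup E] [NormedSpace ℝ E]
    {a b t₀ K : ℝ} (ht₀ : t₀ ∈ Icc a b) (hK : 0 ≤ K) {α α' : ℝ → E}
    (hα : ∀ t ∈ Icc a b, HasDerivWithinAt α (α' t) (Icc a b) t)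
    (hbd : ∀ t ∈ Icc a b, ‖α' t‖ ≤ K * ‖α t‖) {t : ℝ} (ht : t ∈ Icc a b) :
    ‖α t‖ ≤ ‖α t₀‖ * Real.exp (K * (b - a)) := by
  have hexp : ∀ r ≤ b - a, ‖α t₀‖ * Real.exp (K * r) ≤ ‖α t₀‖ * Real.exp (K * (b - a)) := by
    intro r hr
    gcongr
  rcases le_total t₀ t with h | h
  · have h1 := norm_le_gronwallBound_of_norm_deriv_right_le (f := α) (f' := α') (δ := ‖α t₀‖)
      (K := K) (ε := 0) (a := t₀) (b := b)
      (fun s hs => ((hα s ⟨ht₀.1.trans hs.1, hs.2⟩).mono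
        (Icc_subset_Icc_left ht₀.1)).continuousWithinAt)
      (fun s hs => (hα s ⟨ht₀.1.trans hs.1, hs.2.le⟩).mono_of_mem_nhdsWithin
        (Filter.mem_of_superset (Icc_mem_nhdsGE hs.2) (Icc_subset_Icc_left (ht₀.1.trans hs.1))))
      le_rfl (fun s hs => by simpa using hbd s ⟨ht₀.1.trans hs.1, hs.2.le⟩) t ⟨h, ht.2⟩
    rw [gronwallBound_ε0] at h1
    exact h1.trans (hexp _ (by linarith [ht₀.1, ht.2]))
  -- To the left of t₀ Gronwall's inequality is applied to the time-reversed function s ↦ α(-s).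
  · have hneg : ∀ s ∈ Icc (-b) (-a), HasDerivWithinAt (fun s => α (-s)) (-(α' (-s)))
        (Icc (-b) (-a)) s := fun s hs => by
      have := (hα (-s) ⟨by linarith [hs.2], by linarith [hs.1]⟩).scomp s
        ((hasDerivAt_neg s).hasDerivWithinAt (s := Icc (-b) (-a)))
        (fun r hr => ⟨by linarith [hr.2], by linarith [hr.1]⟩)
      simpa [Function.comp_def] using this
    have h1 := norm_le_gronwallBound_of_norm_deriv_right_le (f := fun s => α (-s))
      (f' := fun s => -(α' (-s))) (δ := ‖α t₀‖)
      (K := K) (ε := 0) (a := -t₀) (b := -a)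
      (fun s hs => ((hneg s ⟨by linarith [ht₀.2, hs.1], hs.2⟩).mono
        (Icc_subset_Icc_left (by linarith [ht₀.2]))).continuousWithinAt)
      (fun s hs => (hneg s ⟨by linarith [ht₀.2, hs.1], hs.2.le⟩).mono_of_mem_nhdsWithin
        (Filter.mem_of_superset (Icc_mem_nhdsGE hs.2)
          (Icc_subset_Icc_left (by linarith [ht₀.2, hs.1]))))
      (by simp) (fun s hs => by
        simpa using hbd (-s) ⟨by linarith [hs.2], by linarith [hs.1, ht₀.2]⟩)
      (-t) ⟨by linarith, by linarith [ht.1]⟩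
    rw [gronwallBound_ε0] at h1
    simp only [neg_neg] at h1
    exact h1.trans (hexp _ (by linarith [ht₀.2, ht.1]))

/-- Picard–Lindelöf yields a solution on all of [a, b] only for a suitably bounded field. The
argument of `A t` is therefore truncated at the a priori Gronwall bound B. Truncation does not
increase the norm, so solutions of the truncated equation obey the same bound; the truncation is
then never active along them. -/
theorem exists_hasDerivWithinAt_linear_Icc {ι : Type*} [Fintype ι] {a b t₀ : ℝ}
    (ht₀ : t₀ ∈ Icc a b) {A : ℝ → (ι → ℝ) →L[ℝ] (ι → ℝ)} (hA : ContinuousOn A (Icc a b))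
    (x₀ : ι → ℝ) : ∃ α : ℝ → ι → ℝ, α t₀ = x₀ ∧
      ∀ t ∈ Icc a b, HasDerivWithinAt α (A t (α t)) (Icc a b) t := by
  obtain ⟨K, hK⟩ := isCompact_Icc.exists_bound_of_continuousOn hA
  have hK0 : 0 ≤ K := (norm_nonneg _).trans (hK t₀ ht₀)
  set B := ‖x₀‖ * Real.exp (K * (b - a)) with hB
  have hB0 : 0 ≤ B := by positivity
  have hBB : -B ≤ B := by linarith
  have hab : 0 ≤ b - a := by linarith [ht₀.1, ht₀.2]
  -- The truncated field has norm at most K B, so the radius K B (b - a) leaves room for the whole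
  -- interval.
  have hpl : IsPicardLindelof (fun t x => A t (clampVec hBB x)) (⟨t₀, ht₀⟩ : Icc a b) x₀
      (Real.toNNReal (K * B * (b - a))) 0 (Real.toNNReal (K * B)) (Real.toNNReal K) := by
    refine ⟨fun t ht => ?_, fun x _ => ?_, fun t ht x _ => ?_, ?_⟩
    · refine LipschitzWith.lipschitzOnWith ?_
      have h1 : LipschitzWith (Real.toNNReal K) (A t) :=
        (A t).lipschitz.weaken (by rw [← NNReal.coe_le_coe, Real.coe_toNNReal _ hK0]; exact hK t ht)
      have h2 := h1.comp (lipschitzWith_clampVec hBB)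
      rw [mul_one] at h2
      exact h2
    · exact hA.clm_apply continuousOn_const
    · rw [Real.coe_toNNReal _ (by positivity)]
      exact ((A t).le_opNorm _).trans
        (mul_le_mul (hK t ht) (norm_clampVec_le hBB x) (norm_nonneg _) hK0)
    · rw [Real.coe_toNNReal _ (by positivity), Real.coe_toNNReal _ (by positivity)]
      simp only [NNReal.coe_zero, sub_zero]
      refine mul_le_mul_of_nonneg_left (max_le ?_ ?_) (by positivity)
      · linarith [ht₀.1]
      · linarith [ht₀.2]
  obtain ⟨α, h0, hα⟩ := hpl.exists_eq_forall_mem_Icc_hasDerivWithinAt₀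
  refine ⟨α, h0, fun t ht => ?_⟩
  have hle : ‖α t‖ ≤ B := by
    have := norm_le_of_norm_deriv_le ht₀ hK0 hα (fun s hs => ((A s).le_opNorm _).trans
      (mul_le_mul (hK s hs) (norm_clampVec_le_norm hBB _) (norm_nonneg _) hK0)) ht
    simpa only [h0, hB] using this
  simpa only [clampVec_of_norm_le hBB hle] using hα t ht

/-- The difference of two solutions solves the same equation and vanishes at t₀, so Gronwall's bound
for it is zero. Derivatives within `I` are admitted because the gluing below compares solutions on
intersections of compact intervals. -/
theorem linear_ode_unique {E : Type*} [NormedAddCommGroup E] [NormedSpace ℝ E]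
    {I : Set ℝ} (hI : I.OrdConnected) {A : ℝ → E →L[ℝ] E} (hA : ContinuousOn A I)
    {t₀ : ℝ} (ht₀ : t₀ ∈ I) {α β : ℝ → E}
    (hα : ∀ t ∈ I, HasDerivWithinAt α (A t (α t)) I t)
    (hβ : ∀ t ∈ I, HasDerivWithinAt β (A t (β t)) I t) (h : α t₀ = β t₀) {t : ℝ} (ht : t ∈ I) :
    α t = β t := by
  have hsub : uIcc t₀ t ⊆ I := hI.uIcc_subset ht₀ ht
  obtain ⟨K, hK⟩ := isCompact_uIcc.exists_bound_of_continuousOn (hA.mono hsub)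
  have hK0 : 0 ≤ K := (norm_nonneg _).trans (hK t₀ left_mem_uIcc)
  have := norm_le_of_norm_deriv_le (α := fun s => α s - β s)
    (α' := fun s => A s (α s) - A s (β s)) (K := K) (a := min t₀ t) (b := max t₀ t)
    (t₀ := t₀) left_mem_uIcc hK0
    (fun s hs => ((hα s (hsub hs)).mono hsub).sub ((hβ s (hsub hs)).mono hsub))
    (fun s hs => by
      rw [← map_sub]
      exact ((A s).le_opNorm _).trans (mul_le_mul_of_nonneg_right (hK s hs) (norm_nonneg _)))
    (t := t) right_mem_uIcc
  rw [h, sub_self, norm_zero, zero_mul, norm_le_zero_iff] at this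
  exact sub_eq_zero.1 this

theorem exists_hasDerivAt_linear {ι : Type*} [Fintype ι] {I : Set ℝ} (hI : IsOpen I)
    (hIc : I.OrdConnected) {t₀ : ℝ} (ht₀ : t₀ ∈ I) {A : ℝ → (ι → ℝ) →L[ℝ] (ι → ℝ)}
    (hA : ContinuousOn A I) (x₀ : ι → ℝ) :
    ∃ α : ℝ → ι → ℝ, α t₀ = x₀ ∧ ∀ t ∈ I, HasDerivAt α (A t (α t)) t := by
  have hnhds : ∀ t ∈ I, ∃ a b, t₀ ∈ Icc a b ∧ t ∈ Ioo a b ∧ Icc a b ⊆ I := by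
    intro t ht
    obtain ⟨ε, hε, hball⟩ := Metric.isOpen_iff.1 hI t ht
    have h1 : t - ε / 2 ∈ I := hball (by simp [abs_of_pos hε, hε])
    have h2 : t + ε / 2 ∈ I := hball (by simp [abs_of_pos hε, hε])
    refine ⟨min t₀ (t - ε / 2), max t₀ (t + ε / 2), ⟨min_le_left _ _, le_max_left _ _⟩,
      ⟨(min_le_right _ _).trans_lt (by linarith), lt_of_lt_of_le (by linarith) (le_max_right _ _)⟩,
      hIc.out ?_ ?_⟩
    · rcases min_choice t₀ (t - ε / 2) with h | h <;> rw [h] <;> assumption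
    · rcases max_choice t₀ (t + ε / 2) with h | h <;> rw [h] <;> assumption
  have hsol : ∀ t ∈ I, ∃ (a b : ℝ) (α : ℝ → ι → ℝ), t₀ ∈ Icc a b ∧ t ∈ Ioo a b ∧ Icc a b ⊆ I ∧
      α t₀ = x₀ ∧ ∀ t ∈ Icc a b, HasDerivWithinAt α (A t (α t)) (Icc a b) t := by
    intro t ht
    obtain ⟨a, b, h0, h1, h2⟩ := hnhds t ht
    obtain ⟨α, h3, h4⟩ := exists_hasDerivWithinAt_linear_Icc h0 (hA.mono h2) x₀
    exact ⟨a, b, α, h0, h1, h2, h3, h4⟩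
  choose! a b α h0 h1 h2 h3 h4 using hsol
  -- The global solution takes at t the value of the solution chosen for t. By uniqueness it
  -- coincides near t with that one solution, which makes it differentiable there.
  have key : ∀ t ∈ I, ∀ s ∈ Ioo (a t) (b t), α s s = α t s := by
    intro t ht s hs
    have hsI : s ∈ I := h2 t ht (Ioo_subset_Icc_self hs)
    refine linear_ode_unique (I := Icc (a s) (b s) ∩ Icc (a t) (b t)) (t₀ := t₀)
      (ordConnected_Icc.inter ordConnected_Icc)
      (hA.mono (inter_subset_left.trans (h2 s hsI))) ⟨h0 s hsI, h0 t ht⟩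
      (fun r hr => (h4 s hsI r hr.1).mono inter_subset_left)
      (fun r hr => (h4 t ht r hr.2).mono inter_subset_right)
      ((h3 s hsI).trans (h3 t ht).symm)
      ⟨Ioo_subset_Icc_self (h1 s hsI), Ioo_subset_Icc_self hs⟩
  refine ⟨fun t => α t t, h3 t₀ ht₀, fun t ht => ?_⟩
  refine ((h4 t ht t (Ioo_subset_Icc_self (h1 t ht))).hasDerivAt
    (Icc_mem_nhds (h1 t ht).1 (h1 t ht).2)).congr_of_eventuallyEq ?_
  filter_upwards [Ioo_mem_nhds (h1 t ht).1 (h1 t ht).2] with s hs using key t ht s hs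

/-! ### The group and its action on jets -/

theorem sympForm_mulVec {L : Matrix (Fin 4) (Fin 4) ℝ} (hL : Lᵀ * sympJ * L = sympJ)
    (x y : Fin 4 → ℝ) : sympForm (L *ᵥ x) (L *ᵥ y) = sympForm x y := by
  conv_rhs => rw [sympForm, ← hL]
  rw [sympForm, ← mulVec_mulVec, ← mulVec_mulVec, dotProduct_mulVec x, vecMul_transpose]

theorem linPart_mul {g h : Matrix (Fin 5) (Fin 5) ℝ} (hh : h 0 = Pi.single 0 1) :
    linPart (g * h) = linPart g * linPart h := by
  ext i j
  simp [linPart, Matrix.mul_apply, Fin.sum_univ_succ (n := 4), hh]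

theorem linPart_one : linPart 1 = 1 := by
  simp [linPart, Matrix.submatrix_one _ (Fin.succ_injective _)]

theorem det_eq_det_linPart {g : Matrix (Fin 5) (Fin 5) ℝ} (hg : g 0 = Pi.single 0 1) :
    g.det = (linPart g).det := by
  rw [Matrix.det_succ_row_zero, Fin.sum_univ_succ]
  simp [hg, linPart]

theorem det_sympJ : sympJ.det = 1 := by
  simp [sympJ, Matrix.det_succ_row_zero, Fin.sum_univ_succ, Fin.succAbove]

theorem isUnit_det_of_mem_affSp {g : Matrix (Fin 5) (Fin 5) ℝ} (hg : g ∈ affSp) :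
    IsUnit g.det := by
  have h := congrArg Matrix.det hg.2
  rw [Matrix.det_mul, Matrix.det_mul, Matrix.det_transpose, det_sympJ] at h
  rw [det_eq_det_linPart hg.1, isUnit_iff_ne_zero]
  rintro h0
  simp [h0] at h

theorem row_zero_mul {n : ℕ} {g : Matrix (Fin 5) (Fin 5) ℝ} (hg : g 0 = Pi.single 0 1)
    (h : Matrix (Fin 5) (Fin n) ℝ) : (g * h) 0 = h 0 := by
  rw [Matrix.mul_apply_eq_vecMul, hg, single_one_vecMul]
  rfl

theorem one_mem_affSp : (1 : Matrix (Fin 5) (Fin 5) ℝ) ∈ affSp := by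
  refine ⟨?_, by simp [linPart_one]⟩
  funext j
  rw [Matrix.one_apply, Pi.single_apply]
  simp [eq_comm]

theorem mul_mem_affSp {g h : Matrix (Fin 5) (Fin 5) ℝ} (hg : g ∈ affSp) (hh : h ∈ affSp) :
    g * h ∈ affSp := by
  refine ⟨(row_zero_mul hg.1 h).trans hh.1, ?_⟩
  have : (linPart h)ᵀ * ((linPart g)ᵀ * sympJ * linPart g) * linPart h = sympJ := by
    rw [hg.2, hh.2]
  rw [linPart_mul hh.1, Matrix.transpose_mul]
  simpa only [Matrix.mul_assoc] using this

theorem inv_mem_affSp {g : Matrix (Fin 5) (Fin 5) ℝ} (hg : g ∈ affSp) : g⁻¹ ∈ affSp := by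
  have h1 : g * g⁻¹ = 1 := Matrix.mul_nonsing_inv _ (isUnit_det_of_mem_affSp hg)
  have h0 : g⁻¹ 0 = Pi.single 0 1 := by
    rw [← row_zero_mul hg.1 g⁻¹, h1, one_mem_affSp.1]
  refine ⟨h0, ?_⟩
  have h2 : linPart g * linPart g⁻¹ = 1 := by rw [← linPart_mul h0, h1, linPart_one]
  have h3 : (linPart g⁻¹)ᵀ * ((linPart g)ᵀ * sympJ * linPart g) * linPart g⁻¹ = sympJ := by
    calc _ = (linPart g * linPart g⁻¹)ᵀ * sympJ * (linPart g * linPart g⁻¹) := by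
          rw [Matrix.transpose_mul]; simp only [Matrix.mul_assoc]
      _ = sympJ := by simp [h2]
  rwa [hg.2] at h3

theorem jetMatrix_injective {k : ℕ} {z w : Jet k} (h1 : z.1 = w.1)
    (h : jetMatrix z = jetMatrix w) : z = w := by
  refine Prod.ext h1 (funext fun i => funext fun a => ?_)
  exact congrFun (congrFun h a.succ) i

theorem jetMatrix_act {k : ℕ} {g : Matrix (Fin 5) (Fin 5) ℝ} (hg : g 0 = Pi.single 0 1)
    (z : Jet k) : jetMatrix (act g z) = g * jetMatrix z := by
  ext a i
  refine Fin.cases ?_ (fun a => rfl) a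
  rw [row_zero_mul hg]
  rfl

theorem act_act {k : ℕ} (g : Matrix (Fin 5) (Fin 5) ℝ) {h : Matrix (Fin 5) (Fin 5) ℝ}
    (hh : h 0 = Pi.single 0 1) (z : Jet k) : act g (act h z) = act (g * h) z := by
  rw [act, jetMatrix_act hh, ← Matrix.mul_assoc]
  rfl

theorem act_one {k : ℕ} (z : Jet k) : act 1 z = z := by
  rw [act, Matrix.one_mul]
  rfl

theorem act_inv_act {k : ℕ} {g : Matrix (Fin 5) (Fin 5) ℝ} (hg : g ∈ affSp) (z : Jet k) :
    act g⁻¹ (act g z) = z := by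
  rw [act_act _ hg.1, Matrix.nonsing_inv_mul _ (isUnit_det_of_mem_affSp hg), act_one]

theorem act_succ {k : ℕ} (g : Matrix (Fin 5) (Fin 5) ℝ) (z : Jet (k + 1)) (i : Fin (k + 1)) :
    (act g z).2 i.succ = linPart g *ᵥ z.2 i.succ := by
  funext a
  simp [act, jetMatrix, linPart, Matrix.mul_apply, mulVec, dotProduct,
    Fin.sum_univ_succ (n := 4)]

theorem act_zero {k : ℕ} (g : Matrix (Fin 5) (Fin 5) ℝ) (z : Jet k) :
    (act g z).2 0 = affAct g (z.2 0) := by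
  funext a
  simp [act, jetMatrix, affAct, Matrix.mul_apply, mulVec, dotProduct,
    Fin.sum_univ_succ (n := 4)]

theorem sympForm_act {k : ℕ} {g : Matrix (Fin 5) (Fin 5) ℝ} (hg : g ∈ affSp) (z : Jet (k + 1))
    (i j : Fin (k + 1)) : sympForm ((act g z).2 i.succ) ((act g z).2 j.succ) =
      sympForm (z.2 i.succ) (z.2 j.succ) := by
  rw [act_succ, act_succ, sympForm_mulVec hg.2]

theorem det_jetMatrix (z : Jet 4) : (jetMatrix z).det = phi z := by
  rw [Matrix.det_succ_row_zero, Fin.sum_univ_succ]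
  simp [jetMatrix, phi]
  rfl

/-- A matrix carrying a nondegenerate jet to a jet with the same symplectic products lies in the
affine symplectic group. -/
theorem mul_inv_mem_affSp {z w : Jet 4} (hz : phi z ≠ 0)
    (h : ∀ i j : Fin 4, sympForm (w.2 i.succ) (w.2 j.succ) = sympForm (z.2 i.succ) (z.2 j.succ)) :
    jetMatrix w * (jetMatrix z)⁻¹ ∈ affSp := by
  have hu : IsUnit (jetMatrix z).det := by rwa [det_jetMatrix, isUnit_iff_ne_zero]
  set g := jetMatrix w * (jetMatrix z)⁻¹ with hg
  have hgz : g * jetMatrix z = jetMatrix w := by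
    rw [hg, Matrix.mul_assoc, Matrix.nonsing_inv_mul _ hu, Matrix.mul_one]
  have hrow : ∀ z : Jet 4, jetMatrix z 0 = Pi.single 0 1 := fun _ => rfl
  have h0 : (jetMatrix z)⁻¹ 0 = Pi.single 0 1 := by
    rw [← row_zero_mul (hrow z) (jetMatrix z)⁻¹, Matrix.mul_nonsing_inv _ hu, one_mem_affSp.1]
  refine ⟨by rw [hg, row_zero_mul (hrow w), h0], ?_⟩
  have hL : linPart g * linPart (jetMatrix z) = linPart (jetMatrix w) := by
    rw [← linPart_mul (hrow z), hgz]
  have hgram : ∀ z : Jet 4, (linPart (jetMatrix z))ᵀ * sympJ * linPart (jetMatrix z) =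
      Matrix.of fun i j : Fin 4 => sympForm (z.2 i.succ) (z.2 j.succ) := by
    intro z
    ext i j
    rw [Matrix.mul_assoc]
    rfl
  have hu' : IsUnit (linPart (jetMatrix z)).det := by rwa [← det_eq_det_linPart (hrow z)]
  -- Multiplied on both sides by the invertible matrix of derivatives, ᵗAJA = J becomes equality of
  -- the two Gram matrices.
  have key : (linPart (jetMatrix z))ᵀ * ((linPart g)ᵀ * sympJ * linPart g) *
      linPart (jetMatrix z) = (linPart (jetMatrix z))ᵀ * sympJ * linPart (jetMatrix z) := by
    calc _ = (linPart g * linPart (jetMatrix z))ᵀ * sympJ *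
          (linPart g * linPart (jetMatrix z)) := by
          rw [Matrix.transpose_mul]; simp only [Matrix.mul_assoc]
      _ = _ := by
          rw [hL, hgram, hgram]
          ext i j
          exact h i j
  have hinj := (Matrix.isUnit_iff_isUnit_det _).2 hu'
  have hinjT := (Matrix.isUnit_iff_isUnit_det _).2
    ((Matrix.det_transpose (linPart (jetMatrix z))).symm ▸ hu')
  exact hinjT.mul_left_cancel (hinj.mul_right_cancel key)

/-! ### Normalization -/

theorem sympForm_act_four {g : Matrix (Fin 5) (Fin 5) ℝ} (hg : g ∈ affSp) (z : Jet 4) :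
    sympForm ((act g z).2 1) ((act g z).2 2) = sympForm (z.2 1) (z.2 2) ∧
    sympForm ((act g z).2 1) ((act g z).2 3) = sympForm (z.2 1) (z.2 3) ∧
    sympForm ((act g z).2 1) ((act g z).2 4) = sympForm (z.2 1) (z.2 4) ∧
    sympForm ((act g z).2 2) ((act g z).2 3) = sympForm (z.2 2) (z.2 3) ∧
    sympForm ((act g z).2 2) ((act g z).2 4) = sympForm (z.2 2) (z.2 4) ∧
    sympForm ((act g z).2 3) ((act g z).2 4) = sympForm (z.2 3) (z.2 4) :=
  have h := sympForm_act hg z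
  ⟨h 0 1, h 0 2, h 0 3, h 1 2, h 1 3, h 2 3⟩

theorem phi_act {g : Matrix (Fin 5) (Fin 5) ℝ} (hg : g ∈ affSp) (z : Jet 4) :
    phi (act g z) = phi z := by
  obtain ⟨h12, h13, h14, h23, h24, h34⟩ := sympForm_act_four hg z
  rw [phi_eq_phiJet, phi_eq_phiJet, phiJet_eq, phiJet_eq, h12, h13, h14, h23, h24, h34]

theorem act_mem_regJets {g : Matrix (Fin 5) (Fin 5) ℝ} (hg : g ∈ affSp) {z : Jet 4}
    (hz : z ∈ regJets) : act g z ∈ regJets := by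
  rw [mem_regJets] at hz ⊢
  exact ⟨(sympForm_act hg z 1 2).trans_ne hz.1, (phi_act hg z).trans_ne hz.2⟩

theorem normJet_act {g : Matrix (Fin 5) (Fin 5) ℝ} (hg : g ∈ affSp) (z : Jet 4) :
    normJet (act g z) = normJet z := by
  obtain ⟨h12, h13, h14, h23, h24, h34⟩ := sympForm_act_four hg z
  rw [normJet_eq, normJet_eq, h12, h13, h14, h23, h24, h34]
  rfl

/-- The normal form solves the Gram equations: once the section's coordinates are fixed, each
product determines one remaining entry. The entry -k3 / k2 comes from Λ(n₃, n₄) = k3, which is where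
k2 ≠ 0 enters. -/
theorem sympForm_normVal (k1 dk1 ddk1 dk2 k3 : ℝ) {k2 : ℝ} (h2 : k2 ≠ 0) (n : Fin 5 → Fin 4 → ℝ)
    (hn : n = (normVal k1 dk1 ddk1 k2 dk2 k3)ᵀ) :
    sympForm (n 1) (n 2) = k1 ∧ sympForm (n 1) (n 3) = dk1 ∧
    sympForm (n 1) (n 4) = ddk1 - k2 ∧ sympForm (n 2) (n 3) = k2 ∧
    sympForm (n 2) (n 4) = dk2 ∧ sympForm (n 3) (n 4) = k3 := by
  subst hn
  refine ⟨?_, ?_, ?_, ?_, ?_, ?_⟩ <;> simp [sympForm_apply, normVal]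
  field_simp

theorem normVal_mem_crossSec (t k1 dk1 ddk1 dk2 k3 : ℝ) {k2 : ℝ} (h2 : k2 ≠ 0)
    (hφ : phiVal k1 dk1 ddk1 k2 dk2 k3 ≠ 0) :
    ((t, (normVal k1 dk1 ddk1 k2 dk2 k3)ᵀ) : Jet 4) ∈ crossSec := by
  obtain ⟨h12, h13, h14, h23, h24, h34⟩ := sympForm_normVal k1 dk1 ddk1 dk2 k3 h2 _ rfl
  refine ⟨?_, mem_regJets.2 ⟨?_, ?_⟩⟩
  · simp [secVariety, secMap, secVal, normVal]
  · rwa [h23]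
  · rwa [phi_eq_phiJet, phiJet_eq, h12, h13, h14, h23, h24, h34, add_sub_cancel]

theorem normJet_mem_crossSec {z : Jet 4} (hz : z ∈ regJets) : normJet z ∈ crossSec := by
  rw [mem_regJets] at hz
  rw [normJet_eq]
  exact normVal_mem_crossSec _ _ _ _ _ _ hz.1 (by rw [← phiJet_eq, ← phi_eq_phiJet]; exact hz.2)

theorem sympForm_normJet {z : Jet 4} (hz : z ∈ regJets) (i j : Fin 4) :
    sympForm ((normJet z).2 i.succ) ((normJet z).2 j.succ) =
      sympForm (z.2 i.succ) (z.2 j.succ) := by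
  rw [mem_regJets] at hz
  have hn := congrArg Prod.snd (normJet_eq z)
  obtain ⟨h12, h13, h14, h23, h24, h34⟩ := sympForm_normVal _ _ _ _ _ hz.1 _ hn
  rw [add_sub_cancel_left] at h14
  have hanti : ∀ x y, sympForm x y = -sympForm y x := fun x y => by
    rw [sympForm_apply, sympForm_apply]; ring
  have hsymm : ∀ x y x' y', sympForm x y = sympForm x' y' → sympForm y x = sympForm y' x' := by
    intro x y x' y' h
    rw [hanti y, h, ← hanti]
  fin_cases i <;> fin_cases j
  all_goals first
    | assumption
    | (refine hsymm _ _ _ _ ?_; assumption)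
    | rw [sympForm_self, sympForm_self]

theorem exists_of_mem_secVariety {z : Jet 4} (hz : z ∈ secVariety) : ∃ a b c p q r : ℝ,
    z.2 0 = 0 ∧ z.2 1 = ![1, 0, 0, 0] ∧ z.2 2 = ![0, 1, a, 0] ∧
    z.2 3 = ![0, 0, b, c] ∧ z.2 4 = ![0, p, q, r] := by
  refine ⟨z.2 2 2, z.2 3 2, z.2 3 3, z.2 4 1, z.2 4 2, z.2 4 3, ?_⟩
  simp [secVariety, secMap, secVal, funext_iff, Fin.forall_fin_succ] at hz ⊢
  tauto

/-- The six free coordinates of a point of the section are recovered from its symplectic products.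
Together with `normJet_act` this shows that an orbit meets the section at most once. -/
theorem normJet_of_mem_crossSec {z : Jet 4} (hz : z ∈ crossSec) : normJet z = z := by
  obtain ⟨hz1, hz2⟩ := hz
  obtain ⟨a, b, c, p, q, r, h0, h1, h2, h3, h4⟩ := exists_of_mem_secVariety hz1
  have hk := (mem_regJets.1 hz2).1
  rw [h2, h3] at hk
  simp [sympForm_apply] at hk
  refine Prod.ext rfl (funext fun i => ?_)
  rw [normJet_eq, h1, h2, h3, h4]
  fin_cases i
  · refine Eq.trans ?_ h0.symm
    funext a
    fin_cases a <;> simp [normVal]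
  · refine Eq.trans ?_ h1.symm
    funext a
    fin_cases a <;> simp [normVal]
  · refine Eq.trans ?_ h2.symm
    funext a
    fin_cases a <;> simp [normVal, sympForm_apply]
  · refine Eq.trans ?_ h3.symm
    funext a
    fin_cases a <;> simp [normVal, sympForm_apply]
  · refine Eq.trans ?_ h4.symm
    funext a
    fin_cases a <;> simp [normVal, sympForm_apply]
    field_simp

/-! ### Smoothness and derivatives of matrix-valued functions -/

section MatrixCalculus

variable {E : Type*} [NormedAddCommGroup E] [NormedSpace ℝ E] {s : Set E} {n : WithTop ℕ∞}
  {ι : Type*} [Fintype ι] [DecidableEq ι]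

theorem contDiffOn_mul_apply {l m p : Type*} [Fintype m] {A : E → Matrix l m ℝ}
    {B : E → Matrix m p ℝ} (hA : ∀ i j, ContDiffOn ℝ n (fun x => A x i j) s)
    (hB : ∀ i j, ContDiffOn ℝ n (fun x => B x i j) s) (i : l) (j : p) :
    ContDiffOn ℝ n (fun x => (A x * B x) i j) s := by
  simp only [Matrix.mul_apply]
  exact ContDiffOn.sum fun k _ => (hA i k).mul (hB k j)

theorem contDiffOn_det {A : E → Matrix ι ι ℝ} (hA : ∀ i j, ContDiffOn ℝ n (fun x => A x i j) s) :
    ContDiffOn ℝ n (fun x => (A x).det) s := by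
  simp only [Matrix.det_apply]
  exact ContDiffOn.sum fun σ _ => (contDiffOn_prod fun i _ => hA (σ i) i).const_smul _

theorem contDiffOn_inv_apply {A : E → Matrix ι ι ℝ}
    (hA : ∀ i j, ContDiffOn ℝ n (fun x => A x i j) s) (h0 : ∀ x ∈ s, (A x).det ≠ 0) (i j : ι) :
    ContDiffOn ℝ n (fun x => (A x)⁻¹ i j) s := by
  simp only [Matrix.inv_def, Ring.inverse_eq_inv', Matrix.smul_apply, smul_eq_mul,
    Matrix.adjugate_apply]
  refine ((contDiffOn_det hA).inv h0).mul (contDiffOn_det fun k l => ?_)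
  simp only [Matrix.updateRow_apply]
  split_ifs
  · exact contDiffOn_const
  · exact hA k l

theorem hasDerivAt_mul_apply {l m p : Type*} [Fintype m] {A : ℝ → Matrix l m ℝ}
    {B : ℝ → Matrix m p ℝ} {A' : Matrix l m ℝ} {B' : Matrix m p ℝ} {t : ℝ}
    (hA : ∀ i j, HasDerivAt (fun x => A x i j) (A' i j) t)
    (hB : ∀ i j, HasDerivAt (fun x => B x i j) (B' i j) t) (i : l) (j : p) :
    HasDerivAt (fun x => (A x * B x) i j) ((A' * B t + A t * B') i j) t := by
  simp only [Matrix.mul_apply, Matrix.add_apply, ← Finset.sum_add_distrib]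
  exact HasDerivAt.fun_sum fun k _ => (hA i k).mul (hB k j)

end MatrixCalculus

/-! ### The Serret–Frenet identity -/

/-- The derivative of the matrix of the normalized invariants; `dk`, `ddk`, `dddk` stand for the
derivatives of `k`. -/
def normMatDeriv (dk1 ddk1 dddk1 k2 dk2 ddk2 k3 dk3 : ℝ) : Matrix (Fin 5) (Fin 5) ℝ :=
  !![0, 0, 0, 0, 0;
     0, 0, 0, 0, 0;
     0, 0, 0, 0, -((dk3 * k2 - k3 * dk2) / k2 ^ 2);
     0, 0, dk1, ddk1, dddk1 - dk2;
     0, 0, 0, dk2, ddk2]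

/-- The normalized fifth derivative. -/
def normNext (k1 dk1 ddk1 dddk1 k2 dk2 ddk2 k3 dk3 τ : ℝ) : Fin 4 → ℝ :=
  ![τ * phiVal k1 dk1 ddk1 k2 dk2 k3 / k2,
    -((dk3 + dk1 * (τ * phiVal k1 dk1 ddk1 k2 dk2 k3 / k2)) / k2),
    dddk1 - 2 * dk2,
    ddk2 - k3 + k1 * (τ * phiVal k1 dk1 ddk1 k2 dk2 k3 / k2)]

/-- The matrix of the normalized derivatives of orders one to five. -/
def normMatShift (k1 dk1 ddk1 dddk1 k2 dk2 ddk2 k3 dk3 τ : ℝ) : Matrix (Fin 5) (Fin 5) ℝ :=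
  Matrix.of (Fin.cons 0 fun a => Fin.snoc (fun i : Fin 4 => normVal k1 dk1 ddk1 k2 dk2 k3 a i.succ)
    (normNext k1 dk1 ddk1 dddk1 k2 dk2 ddk2 k3 dk3 τ a) : Fin 5 → Fin 5 → ℝ)

theorem normMatShift_eq (k1 dk1 ddk1 dddk1 k2 dk2 ddk2 k3 dk3 τ : ℝ) :
    normMatShift k1 dk1 ddk1 dddk1 k2 dk2 ddk2 k3 dk3 τ =
    !![0, 0, 0, 0, 0;
       1, 0, 0, 0, normNext k1 dk1 ddk1 dddk1 k2 dk2 ddk2 k3 dk3 τ 0;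
       0, 1, 0, -(k3 / k2), normNext k1 dk1 ddk1 dddk1 k2 dk2 ddk2 k3 dk3 τ 1;
       0, k1, dk1, ddk1 - k2, normNext k1 dk1 ddk1 dddk1 k2 dk2 ddk2 k3 dk3 τ 2;
       0, 0, k2, dk2, normNext k1 dk1 ddk1 dddk1 k2 dk2 ddk2 k3 dk3 τ 3] := by
  ext i j
  fin_cases i <;> fin_cases j <;> rfl

theorem jetMatrix_normVal (t k1 dk1 ddk1 k2 dk2 k3 : ℝ) :
    jetMatrix ((t, (normVal k1 dk1 ddk1 k2 dk2 k3)ᵀ) : Jet 4) =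
    !![1, 0, 0, 0, 0;
       0, 1, 0, 0, 0;
       0, 0, 1, 0, -(k3 / k2);
       0, 0, k1, dk1, ddk1 - k2;
       0, 0, 0, k2, dk2] := by
  ext i j
  fin_cases i <;> fin_cases j <;> rfl

/-- This is M N = S - N'. The quantities `dddk1`, `ddk2`, `dk3` cancel between S and N', so `τ` is
the only fifth order quantity left, and here it is a free parameter. -/
theorem frenetVal_mul_normVal (t k1 dk1 ddk1 dddk1 dk2 ddk2 k3 dk3 τ : ℝ) {k2 : ℝ} (h2 : k2 ≠ 0) :
    frenetVal k1 dk1 k2 k3 τ * jetMatrix ((t, (normVal k1 dk1 ddk1 k2 dk2 k3)ᵀ) : Jet 4) =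
      normMatShift k1 dk1 ddk1 dddk1 k2 dk2 ddk2 k3 dk3 τ -
        normMatDeriv dk1 ddk1 dddk1 k2 dk2 ddk2 k3 dk3 := by
  rw [jetMatrix_normVal, normMatShift_eq]
  ext i j
  fin_cases i <;> fin_cases j <;>
    simp [frenetVal, normMatDeriv, normNext, phiVal, Matrix.mul_apply, Fin.sum_univ_succ] <;>
    field_simp <;> ring

/-- The factor `c` is the dt-component of the direction of differentiation: 1 along a curve, `v.1`
for a contact vector `v`. As it may vanish, it cannot be normalized away. The time `w` does not
enter the jet matrix. -/
theorem hasDerivAt_normVal {k1 k2 k3 dk1 dk2 ddk1 : ℝ → ℝ} {dddk1 ddk2 dk3 c t : ℝ}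
    (h0 : k2 t ≠ 0) (hk1 : HasDerivAt k1 (c * dk1 t) t) (hdk1 : HasDerivAt dk1 (c * ddk1 t) t)
    (hddk1 : HasDerivAt ddk1 (c * dddk1) t) (hk2 : HasDerivAt k2 (c * dk2 t) t)
    (hdk2 : HasDerivAt dk2 (c * ddk2) t) (hk3 : HasDerivAt k3 (c * dk3) t)
    (w : ℝ → ℝ) (i j : Fin 5) :
    HasDerivAt (fun s => jetMatrix
      ((w s, (normVal (k1 s) (dk1 s) (ddk1 s) (k2 s) (dk2 s) (k3 s))ᵀ) : Jet 4) i j)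
      ((c • normMatDeriv (dk1 t) (ddk1 t) dddk1 (k2 t) (dk2 t) ddk2 (k3 t) dk3) i j) t := by
  have h00 : HasDerivAt (fun _ : ℝ => (0 : ℝ)) (c * 0) t := by
    rw [mul_zero]; exact hasDerivAt_const _ _
  have h11 : HasDerivAt (fun _ : ℝ => (1 : ℝ)) (c * 0) t := by
    rw [mul_zero]; exact hasDerivAt_const _ _
  simp only [jetMatrix_normVal]
  fin_cases i <;> fin_cases j <;> first
    | exact h00
    | exact h11
    | exact hk1
    | exact hdk1
    | exact hk2
    | exact hdk2
    | exact (hddk1.sub hk2).congr_deriv (mul_sub _ _ _).symm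
    | exact (hk3.div hk2 h0).neg.congr_deriv (by
        simp only [normMatDeriv, Matrix.smul_apply, smul_eq_mul]
        change _ = c * -((dk3 * k2 t - k3 t * dk2 t) / k2 t ^ 2)
        ring)

/-- The products with n₁, …, n₄ determine `x` because these vectors are a basis. The first gives x₃,
the second and third express x₄ and x₂ through x₁, and the last becomes a linear equation for x₁
with leading coefficient φ. -/
theorem eq_normNext {k1 dk1 ddk1 dddk1 k2 dk2 ddk2 k3 dk3 k4 : ℝ} (h2 : k2 ≠ 0)
    (hφ : phiVal k1 dk1 ddk1 k2 dk2 k3 ≠ 0) {n : Fin 5 → Fin 4 → ℝ}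
    (hn : n = (normVal k1 dk1 ddk1 k2 dk2 k3)ᵀ) {x : Fin 4 → ℝ}
    (h15 : sympForm (n 1) x = dddk1 - 2 * dk2) (h25 : sympForm (n 2) x = ddk2 - k3)
    (h35 : sympForm (n 3) x = dk3) (h45 : sympForm (n 4) x = k4) :
    x = normNext k1 dk1 ddk1 dddk1 k2 dk2 ddk2 k3 dk3
      (tauVal k2 dk2 ddk2 k3 dk3 k4 (phiVal k1 dk1 ddk1 k2 dk2 k3)) := by
  subst hn
  simp [sympForm_apply, normVal] at h15 h25 h35 h45
  set φ := phiVal k1 dk1 ddk1 k2 dk2 k3 with hφ'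
  -- Elimination of `x 1` and `x 3`; the right-hand side equals τφ²/k2.
  have hx0 : x 0 * φ = k2 * k4 + k3 * (ddk2 - k3) - dk2 * dk3 := by
    have e : -(k3 * x 3) = k2 * (k4 + (ddk1 - k2) * x 0 + dk2 * x 1) := by
      field_simp at h45
      linear_combination h45
    rw [hφ', phiVal]
    linear_combination e + k3 * h25 - dk2 * h35
  have hτ : tauVal k2 dk2 ddk2 k3 dk3 k4 φ * φ / k2 = x 0 := by
    rw [tauVal]
    field_simp
    linear_combination -hx0
  funext i
  fin_cases i <;> simp only [normNext, ← hφ', hτ]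
  · rfl
  · simp
    field_simp
    linear_combination -h35
  · simpa using h15
  · simp
    linear_combination h25

/-- The converse of the last equation of `eq_normNext`: with τ built from `k4`, the vector of order
five returns `k4` as fourth curvature. Realization rests on this. -/
theorem sympForm_normNext {k1 dk1 ddk1 dddk1 k2 dk2 ddk2 k3 dk3 k4 : ℝ} (h2 : k2 ≠ 0)
    (hφ : phiVal k1 dk1 ddk1 k2 dk2 k3 ≠ 0) :
    sympForm ((normVal k1 dk1 ddk1 k2 dk2 k3)ᵀ 4) (normNext k1 dk1 ddk1 dddk1 k2 dk2 ddk2 k3 dk3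
      (tauVal k2 dk2 ddk2 k3 dk3 k4 (phiVal k1 dk1 ddk1 k2 dk2 k3))) = k4 := by
  set φ := phiVal k1 dk1 ddk1 k2 dk2 k3 with hφ'
  have hτ : tauVal k2 dk2 ddk2 k3 dk3 k4 φ * φ / k2 =
      (k2 * k4 + k3 * (ddk2 - k3) - dk2 * dk3) / φ := by
    rw [tauVal]
    field_simp
    ring
  rw [sympForm_apply]
  simp only [normNext, ← hφ', hτ]
  simp [normVal]
  field_simp
  rw [hφ', phiVal]
  ring

/-! ### The moving frame -/

/-- The moving frame attached to the cross-section. -/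
def frame (z : Jet 4) : Matrix (Fin 5) (Fin 5) ℝ := jetMatrix (normJet z) * (jetMatrix z)⁻¹

theorem isUnit_det_jetMatrix {z : Jet 4} (hz : z ∈ regJets) : IsUnit (jetMatrix z).det := by
  rw [det_jetMatrix, isUnit_iff_ne_zero]
  exact (mem_regJets.1 hz).2

theorem frame_mul_jetMatrix {z : Jet 4} (hz : z ∈ regJets) :
    frame z * jetMatrix z = jetMatrix (normJet z) := by
  rw [frame, Matrix.mul_assoc, Matrix.nonsing_inv_mul _ (isUnit_det_jetMatrix hz), Matrix.mul_one]

theorem frame_mem_affSp {z : Jet 4} (hz : z ∈ regJets) : frame z ∈ affSp :=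
  mul_inv_mem_affSp (mem_regJets.1 hz).2 (sympForm_normJet hz)

theorem act_frame {z : Jet 4} (hz : z ∈ regJets) : act (frame z) z = normJet z :=
  jetMatrix_injective rfl (by rw [jetMatrix_act (frame_mem_affSp hz).1, frame_mul_jetMatrix hz])

theorem frame_act {g : Matrix (Fin 5) (Fin 5) ℝ} (hg : g ∈ affSp) (z : Jet 4) :
    frame (act g z) = frame z * g⁻¹ := by
  rw [frame, frame, normJet_act hg, jetMatrix_act hg.1, Matrix.mul_inv_rev, Matrix.mul_assoc]

/-- Invariance of `normJet`, and the fact that it fixes the section, force `act g z = normJet z`;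
the jet matrix of `z` is then cancelled. -/
theorem eq_frame {z : Jet 4} (hz : z ∈ regJets) {g : Matrix (Fin 5) (Fin 5) ℝ} (hg : g ∈ affSp)
    (h : act g z ∈ crossSec) : g = frame z := by
  rw [frame, ← normJet_act hg, normJet_of_mem_crossSec h, jetMatrix_act hg.1, Matrix.mul_assoc,
    Matrix.mul_nonsing_inv _ (isUnit_det_jetMatrix hz), Matrix.mul_one]

theorem frame_of_mem_crossSec {z : Jet 4} (hz : z ∈ crossSec) : frame z = 1 :=
  (eq_frame hz.2 one_mem_affSp (by rwa [act_one])).symm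

theorem contDiff_phi {n : WithTop ℕ∞} : ContDiff ℝ n phi := by
  rw [← contDiffOn_univ]
  exact contDiffOn_det fun i j => (contDiff_coord _ _).contDiffOn

theorem isOpen_regJets : IsOpen regJets := by
  have : regJets = {z : Jet 4 | sympForm (z.2 2) (z.2 3) ≠ 0} ∩ {z : Jet 4 | phi z ≠ 0} :=
    Set.ext fun z => mem_regJets
  rw [this]
  exact (isOpen_ne_fun (contDiff_sympForm (k := 4) 2 3 (n := 0)).continuous continuous_const).inter
    (isOpen_ne_fun (contDiff_phi (n := 0)).continuous continuous_const)

theorem contDiffOn_jetMatrix {k : ℕ} {n : WithTop ℕ∞} (s : Set (Jet k)) (i : Fin 5)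
    (j : Fin (k + 1)) : ContDiffOn ℝ n (fun z : Jet k => jetMatrix z i j) s :=
  Fin.cases contDiffOn_const (fun a => (contDiff_coord j a).contDiffOn) i

theorem contDiffOn_jetMatrix_normJet (i j : Fin 5) :
    ContDiffOn ℝ ∞ (fun z => jetMatrix (normJet z) i j) regJets := by
  have h : ∀ i j : Fin 5, ContDiffOn ℝ ∞ (fun z : Jet 4 => sympForm (z.2 i) (z.2 j)) regJets :=
    fun i j => (contDiff_sympForm i j).contDiffOn
  simp only [normJet_eq]
  fin_cases i <;> fin_cases j <;> first
    | exact contDiffOn_const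
    | exact h _ _
    | exact ((h 2 3).add (h 1 4)).sub (h 2 3)
    | exact ((h 3 4).div (h 2 3) fun z hz => (mem_regJets.1 hz).1).neg

theorem contDiffOn_frame (i j : Fin 5) : ContDiffOn ℝ ∞ (fun z => frame z i j) regJets :=
  contDiffOn_mul_apply contDiffOn_jetMatrix_normJet
    (contDiffOn_inv_apply (contDiffOn_jetMatrix _) fun z hz => by
      rw [det_jetMatrix]; exact (mem_regJets.1 hz).2) i j

theorem isMovingFrame_frame : IsMovingFrame frame :=
  ⟨contDiffOn_frame, fun z hz => ⟨frame_mem_affSp hz,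
    by rw [act_frame hz]; exact normJet_mem_crossSec hz,
    fun g hg => ⟨act_mem_regJets hg hz, frame_act hg z⟩⟩⟩

/-- The normalized fifth derivative, as a function on `J⁵`. -/
theorem act_frame_five {z : Jet 5} (hz : trunc 4 z ∈ regJets) :
    (act (frame (trunc 4 z)) z).2 5 =
      normNext (sympForm (z.2 1) (z.2 2)) (sympForm (z.2 1) (z.2 3))
        (sympForm (z.2 2) (z.2 3) + sympForm (z.2 1) (z.2 4))
        (2 * sympForm (z.2 2) (z.2 4) + sympForm (z.2 1) (z.2 5))
        (sympForm (z.2 2) (z.2 3)) (sympForm (z.2 2) (z.2 4))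
        (sympForm (z.2 3) (z.2 4) + sympForm (z.2 2) (z.2 5))
        (sympForm (z.2 3) (z.2 4)) (sympForm (z.2 3) (z.2 5)) (tauJet z) := by
  have hr := mem_regJets.1 hz
  have hφ : phi (trunc 4 z) = phiVal (sympForm (z.2 1) (z.2 2)) (sympForm (z.2 1) (z.2 3))
        (sympForm (z.2 2) (z.2 3) + sympForm (z.2 1) (z.2 4)) (sympForm (z.2 2) (z.2 3))
        (sympForm (z.2 2) (z.2 4)) (sympForm (z.2 3) (z.2 4)) := by
    rw [phi_eq_phiJet, phiJet_eq]
    rfl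
  have hn := (congrArg Prod.snd (act_frame hz)).trans
    (congrArg Prod.snd (normJet_eq (trunc 4 z)))
  have hS := sympForm_act (frame_mem_affSp hz) z
  rw [tauJet_eq, hφ]
  -- The products of order five are unchanged by the frame, and Λ₁₅ = κ₁''' - 2κ₂', Λ₂₅ = κ₂'' - κ₃,
  -- Λ₃₅ = κ₃', Λ₄₅ = κ₄.
  refine eq_normNext hr.1 (hφ ▸ hr.2) hn ?_ ?_ ?_ ?_
  · exact (hS 0 4).trans (add_sub_cancel_left _ _).symm
  · exact (hS 1 4).trans (add_sub_cancel_left _ _).symm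
  · exact hS 2 4
  · exact hS 3 4

theorem tau_eq {z : Jet 5} (hz : trunc 4 z ∈ regJets) :
    (act (frame (trunc 4 z)) z).2 3 3 * (act (frame (trunc 4 z)) z).2 5 0 / phi (trunc 4 z) =
      tauJet z := by
  have hr := mem_regJets.1 hz
  have h33 : (act (frame (trunc 4 z)) z).2 3 3 = sympForm (z.2 2) (z.2 3) := by
    have := congrFun (congrFun (congrArg Prod.snd ((act_frame hz).trans (normJet_eq _))) 3) 3
    exact this
  have hk : sympForm (z.2 2) (z.2 3) ≠ 0 := hr.1
  have hφ := phi_eq_phiJet (trunc 4 z)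
  rw [phiJet_eq] at hφ
  rw [h33, act_frame_five hz]
  change _ * (tauJet z * phiVal _ _ _ _ _ _ / _) / _ = _
  rw [div_eq_iff hr.2, mul_div_cancel₀ _ hk]
  exact congrArg _ hφ.symm

/-- The derivative of the moving frame along a path in `J⁴` tangent to the contact distribution. -/
theorem hasDerivAt_frame {w : ℝ → Jet 4} {z : Jet 5} {c t : ℝ} (hz : trunc 4 z ∈ regJets)
    (hw : w t = trunc 4 z) (hw1 : DifferentiableAt ℝ (fun s => (w s).1) t)
    (hw2 : ∀ i : Fin 5, HasDerivAt (fun s => (w s).2 i) (c • z.2 i.succ) t) (i j : Fin 5) :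
    HasDerivAt (fun s => frame (w s) i j) ((-(c • frenetJet z) * frame (w t)) i j) t := by
  have hwd : DifferentiableAt ℝ w t :=
    hw1.prodMk (differentiableAt_pi.2 fun i => (hw2 i).differentiableAt)
  have hmem : ∀ᶠ s in 𝓝 t, w s ∈ regJets :=
    hwd.continuousAt.eventually (isOpen_regJets.mem_nhds (hw ▸ hz))
  have hR : ∀ i j, HasDerivAt (fun s => frame (w s) i j)
      ((Matrix.of fun i j => deriv (fun s => frame (w s) i j) t) i j) t := fun i j => by
    have h1 : DifferentiableAt ℝ (fun z => frame z i j) (w t) :=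
      ((contDiffOn_frame i j).contDiffAt (isOpen_regJets.mem_nhds (hw ▸ hz))).differentiableAt
        (by simp)
    exact (h1.comp t hwd).hasDerivAt
  set R' : Matrix (Fin 5) (Fin 5) ℝ := Matrix.of fun i j => deriv (fun s => frame (w s) i j) t
  let X' : Matrix (Fin 5) (Fin 5) ℝ :=
    Matrix.of (Fin.cons 0 (fun a i => z.2 i.succ a) : Fin 5 → Fin 5 → ℝ)
  have hX : ∀ i j, HasDerivAt (fun s => jetMatrix (w s) i j) ((c • X') i j) t := by
    intro i j
    refine Fin.cases ?_ (fun a => ?_) i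
    · refine (hasDerivAt_const t ((Pi.single 0 1 : Fin 5 → ℝ) j)).congr_deriv ?_
      simp [X']
    · exact hasDerivAt_pi.1 (hw2 j) a
  have hS : ∀ i j : Fin 5, HasDerivAt (fun s => sympForm ((w s).2 i) ((w s).2 j))
      (c * (sympForm (z.2 i.succ) (z.2 j.castSucc) + sympForm (z.2 i.castSucc) (z.2 j.succ)))
      t := by
    intro i j
    refine ((hw2 i).sympForm (hw2 j)).congr_deriv ?_
    rw [hw]
    change sympForm (c • z.2 i.succ) (z.2 j.castSucc) + sympForm (z.2 i.castSucc) (c • z.2 j.succ)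
      = _
    simp only [sympForm_apply, Pi.smul_apply, smul_eq_mul]
    ring
  have hN : ∀ i j, HasDerivAt (fun s => jetMatrix (normJet (w s)) i j) ((c • normMatDeriv
      (sympForm (z.2 1) (z.2 3)) (sympForm (z.2 2) (z.2 3) + sympForm (z.2 1) (z.2 4))
      (2 * sympForm (z.2 2) (z.2 4) + sympForm (z.2 1) (z.2 5))
      (sympForm (z.2 2) (z.2 3)) (sympForm (z.2 2) (z.2 4))
      (sympForm (z.2 3) (z.2 4) + sympForm (z.2 2) (z.2 5))
      (sympForm (z.2 3) (z.2 4)) (sympForm (z.2 3) (z.2 5))) i j) t := by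
    intro i j
    simp only [normJet_eq]
    have := hasDerivAt_normVal (c := c) (t := t)
      (k1 := fun s => sympForm ((w s).2 1) ((w s).2 2))
      (dk1 := fun s => sympForm ((w s).2 1) ((w s).2 3))
      (ddk1 := fun s => sympForm ((w s).2 2) ((w s).2 3) + sympForm ((w s).2 1) ((w s).2 4))
      (k2 := fun s => sympForm ((w s).2 2) ((w s).2 3))
      (dk2 := fun s => sympForm ((w s).2 2) ((w s).2 4))
      (k3 := fun s => sympForm ((w s).2 3) ((w s).2 4))
      (dddk1 := 2 * sympForm (z.2 2) (z.2 4) + sympForm (z.2 1) (z.2 5))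
      (ddk2 := sympForm (z.2 3) (z.2 4) + sympForm (z.2 2) (z.2 5))
      (dk3 := sympForm (z.2 3) (z.2 5))
      (by simp only [hw]; exact (mem_regJets.1 hz).1)
      ((hS 1 2).congr_deriv ?_) ((hS 1 3).congr_deriv ?_)
      (((hS 2 3).add (hS 1 4)).congr_deriv ?_)
      ((hS 2 3).congr_deriv ?_) ((hS 2 4).congr_deriv ?_) ((hS 3 4).congr_deriv ?_)
      (fun s => (w s).1) i j
    · simp only [hw] at this
      exact this
    · simp only [hw]
      change c * (sympForm (z.2 2) (z.2 2) + sympForm (z.2 1) (z.2 3)) =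
        c * sympForm (z.2 1) (z.2 3)
      rw [sympForm_self, zero_add]
    · simp only [hw]
      rfl
    · change c * (sympForm (z.2 3) (z.2 3) + sympForm (z.2 2) (z.2 4)) +
        c * (sympForm (z.2 2) (z.2 4) + sympForm (z.2 1) (z.2 5)) = _
      rw [sympForm_self]
      ring
    · simp only [hw]
      change c * (sympForm (z.2 3) (z.2 3) + sympForm (z.2 2) (z.2 4)) =
        c * sympForm (z.2 2) (z.2 4)
      rw [sympForm_self, zero_add]
    · rfl
    · change c * (sympForm (z.2 4) (z.2 4) + sympForm (z.2 3) (z.2 5)) =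
        c * sympForm (z.2 3) (z.2 5)
      rw [sympForm_self, zero_add]
  -- Derivative of the identity R X = N, valid for all s near t because the regular set is open.
  have hRX : R' * jetMatrix (w t) + frame (w t) * (c • X') = c • normMatDeriv
      (sympForm (z.2 1) (z.2 3)) (sympForm (z.2 2) (z.2 3) + sympForm (z.2 1) (z.2 4))
      (2 * sympForm (z.2 2) (z.2 4) + sympForm (z.2 1) (z.2 5))
      (sympForm (z.2 2) (z.2 3)) (sympForm (z.2 2) (z.2 4))
      (sympForm (z.2 3) (z.2 4) + sympForm (z.2 2) (z.2 5))
      (sympForm (z.2 3) (z.2 4)) (sympForm (z.2 3) (z.2 5)) := by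
    ext i j
    refine (hasDerivAt_mul_apply hR hX i j).unique ((hN i j).congr_of_eventuallyEq ?_)
    filter_upwards [hmem] with s hs
    rw [frame_mul_jetMatrix hs]
  have hnorm : normJet (trunc 4 z) = ((z.1, (normVal (sympForm (z.2 1) (z.2 2))
      (sympForm (z.2 1) (z.2 3)) (sympForm (z.2 2) (z.2 3) + sympForm (z.2 1) (z.2 4))
      (sympForm (z.2 2) (z.2 3)) (sympForm (z.2 2) (z.2 4)) (sympForm (z.2 3) (z.2 4)))ᵀ) : Jet 4) :=
    normJet_eq _
  -- The first row of `X'` is zero, so the translation part of the frame drops out and the columns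
  -- are the normalized derivatives of orders one to five.
  have hshift : frame (trunc 4 z) * X' = normMatShift
      (sympForm (z.2 1) (z.2 2)) (sympForm (z.2 1) (z.2 3))
      (sympForm (z.2 2) (z.2 3) + sympForm (z.2 1) (z.2 4))
      (2 * sympForm (z.2 2) (z.2 4) + sympForm (z.2 1) (z.2 5))
      (sympForm (z.2 2) (z.2 3)) (sympForm (z.2 2) (z.2 4))
      (sympForm (z.2 3) (z.2 4) + sympForm (z.2 2) (z.2 5))
      (sympForm (z.2 3) (z.2 4)) (sympForm (z.2 3) (z.2 5)) (tauJet z) := by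
    have hcol : ∀ (a : Fin 4) (j : Fin 5), (frame (trunc 4 z) * X') a.succ j =
        (act (frame (trunc 4 z)) z).2 j.succ a := by
      intro a j
      change _ = (frame (trunc 4 z) * jetMatrix z) a.succ j.succ
      rw [Matrix.mul_apply, Matrix.mul_apply]
      refine Finset.sum_congr rfl fun b _ => congrArg _ ?_
      refine Fin.cases ?_ (fun b => rfl) b
      simp [X', jetMatrix]
    ext i j
    refine Fin.cases ?_ (fun a => ?_) i
    · rw [row_zero_mul (frame_mem_affSp hz).1]
      rfl
    · rw [hcol]
      refine Fin.lastCases ?_ (fun j => ?_) j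
      · change (act (frame (trunc 4 z)) z).2 5 a = _
        rw [act_frame_five hz]
        simp only [normMatShift, Matrix.of_apply, Fin.cons_succ, Fin.snoc_last]
      · have := congrFun (congrFun (congrArg Prod.snd ((act_frame hz).trans hnorm)) j.succ) a
        simp only [normMatShift, Matrix.of_apply, Fin.cons_succ, Fin.snoc_castSucc]
        exact this
  have hfin : R' * jetMatrix (w t) = -(c • frenetJet z) * frame (w t) * jetMatrix (w t) := by
    have hk : sympForm (z.2 2) (z.2 3) ≠ 0 := (mem_regJets.1 hz).1
    rw [Matrix.mul_assoc, hw, frame_mul_jetMatrix hz, hnorm, frenetJet_eq, neg_mul, Matrix.smul_mul,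
      frenetVal_mul_normVal _ _ _ _ (2 * sympForm (z.2 2) (z.2 4) + sympForm (z.2 1) (z.2 5)) _
        (sympForm (z.2 3) (z.2 4) + sympForm (z.2 2) (z.2 5)) _ (sympForm (z.2 3) (z.2 5)) _
        hk, ← hshift]
    rw [hw, Matrix.mul_smul] at hRX
    rw [eq_sub_of_add_eq hRX, smul_sub, neg_sub]
  have hX0 : IsUnit (jetMatrix (w t)) :=
    (Matrix.isUnit_iff_isUnit_det _).2 (isUnit_det_jetMatrix (hw ▸ hz))
  rw [← hX0.mul_right_cancel hfin]
  exact hR i j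

/-! ### Transversality to the orbits -/

/-- The element of the Lie algebra with coordinates `c` in the basis `lieBasis`. -/
def lieElt (c : Fin 14 → ℝ) : Matrix (Fin 5) (Fin 5) ℝ :=
  !![0, 0, 0, 0, 0;
     c 0, c 4, c 6, c 8, c 10;
     c 1, c 7, c 5, c 10, c 9;
     c 2, c 11, c 13, -c 4, -c 7;
     c 3, c 13, c 12, -c 6, -c 5]

theorem sum_smul_lieBasis (c : Fin 14 → ℝ) : ∑ i, c i • lieBasis i = lieElt c := by
  ext i j
  simp only [Matrix.sum_apply, Matrix.smul_apply, Fin.sum_univ_succ, Finset.univ_eq_empty,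
    Finset.sum_empty]
  fin_cases i <;> fin_cases j <;>
    simp [lieBasis, lieElt, Fin.succ]

theorem sum_smul_infGen {k : ℕ} (c : Fin 14 → ℝ) (z : Jet k) :
    ∑ i, c i • infGen (lieBasis i) z = infGen (lieElt c) z := by
  rw [← sum_smul_lieBasis]
  refine Prod.ext ?_ (funext fun i => funext fun a => ?_)
  · simp [Prod.fst_sum, infGen]
  · simp [Prod.snd_sum, infGen, Matrix.sum_mul, Matrix.sum_apply]

theorem mem_orbitTangent {k : ℕ} {z v : Jet k} :
    v ∈ orbitTangent z ↔ ∃ c, infGen (lieElt c) z = v := by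
  rw [orbitTangent, Submodule.mem_span_range_iff_exists_fun]
  simp only [sum_smul_infGen]

theorem infGen_succ {k : ℕ} (c : Fin 14 → ℝ) (z : Jet (k + 1)) (i : Fin (k + 1))
    {x : Fin 4 → ℝ} (hx : z.2 i.succ = x) :
    (infGen (lieElt c) z).2 i.succ =
      ![c 4 * x 0 + c 6 * x 1 + c 8 * x 2 + c 10 * x 3,
        c 7 * x 0 + c 5 * x 1 + c 10 * x 2 + c 9 * x 3,
        c 11 * x 0 + c 13 * x 1 - c 4 * x 2 - c 7 * x 3,
        c 13 * x 0 + c 12 * x 1 - c 6 * x 2 - c 5 * x 3] := by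
  refine (act_succ _ z i).trans ?_
  rw [hx]
  funext a
  fin_cases a <;>
    simp [linPart, lieElt, mulVec, dotProduct, Fin.sum_univ_four, Fin.succ] <;> ring

theorem infGen_zero {k : ℕ} (c : Fin 14 → ℝ) {z : Jet k} (hz : z.2 0 = 0) :
    (infGen (lieElt c) z).2 0 = ![c 0, c 1, c 2, c 3] := by
  refine (act_zero _ z).trans ?_
  rw [hz]
  funext a
  fin_cases a <;> simp [affAct, lieElt, mulVec, dotProduct, Fin.sum_univ_succ]

/-- The linear map with the given coordinates of jets. -/
def coordMap {k r : ℕ} (idx : Fin r → Fin (k + 1) × Fin 4) : Jet k →ₗ[ℝ] (Fin r → ℝ) where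
  toFun z j := z.2 (idx j).1 (idx j).2
  map_add' _ _ := rfl
  map_smul' _ _ := rfl

/-- Injectivity is required on generator values rather than on the coefficients `c`: below order
four the isotropy algebra is nontrivial and distinct `c` can give the same tangent vector. -/
theorem isCompl_ker_orbitTangent {k r : ℕ} {L : Jet k →ₗ[ℝ] (Fin r → ℝ)} {z : Jet k}
    (hinj : ∀ c, L (infGen (lieElt c) z) = 0 → infGen (lieElt c) z = 0)
    (hsurj : ∀ y, ∃ c, L (infGen (lieElt c) z) = y) :
    IsCompl (LinearMap.ker L) (orbitTangent z) := by
  constructor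
  · rw [Submodule.disjoint_def]
    intro v hv hv'
    obtain ⟨c, rfl⟩ := mem_orbitTangent.1 hv'
    exact hinj c hv
  · rw [codisjoint_iff, Submodule.eq_top_iff']
    intro u
    obtain ⟨c, hc⟩ := hsurj (L u)
    rw [Submodule.mem_sup]
    exact ⟨u - infGen (lieElt c) z, by simp [hc], _, mem_orbitTangent.2 ⟨c, rfl⟩, by simp⟩

/-- Surjectivity of `L` on the orbit directions serves twice: it makes the equations a submersion
and it gives the spanning half of complementarity. -/
theorem isLocalCrossSectionAt_of_linear {k r : ℕ} {S U : Set (Jet k)}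
    (L : Jet k →ₗ[ℝ] (Fin r → ℝ)) (v : Fin r → ℝ) {z : Jet k} (hzS : z ∈ S) (hzU : z ∈ U)
    (hU : IsOpen U) (hS : S ∩ U = {w ∈ U | L w = v})
    (hinj : ∀ w ∈ S ∩ U, ∀ c, L (infGen (lieElt c) w) = 0 → infGen (lieElt c) w = 0)
    (hsurj : ∀ w ∈ S ∩ U, ∀ y, ∃ c, L (infGen (lieElt c) w) = y) :
    IsLocalCrossSectionAt S z := by
  have hf : ∀ w, fderiv ℝ (fun w => L w - v) w = LinearMap.toContinuousLinearMap L := fun w =>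
    ((LinearMap.toContinuousLinearMap L).hasFDerivAt.sub_const v).fderiv
  refine ⟨hzS, r, fun w => L w - v, U, hU, hzU, ?_, ?_, fun w hw => ?_⟩
  · exact ((LinearMap.toContinuousLinearMap L).contDiff.sub contDiff_const).contDiffOn
  · simpa only [sub_eq_zero] using hS
  · rw [hf]
    refine ⟨fun y => ?_, isCompl_ker_orbitTangent (hinj w hw) (hsurj w hw)⟩
    obtain ⟨c, hc⟩ := hsurj w hw y
    exact ⟨_, hc⟩

/-- The coordinates entering the equations of the cross-section. -/
def secIdx : Fin 14 → Fin 5 × Fin 4 :=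
  ![(0, 0), (0, 1), (0, 2), (0, 3), (1, 0), (1, 1), (1, 2), (1, 3), (2, 0), (2, 1), (2, 3),
    (3, 0), (3, 1), (4, 0)]

theorem secMap_eq : secMap = coordMap (k := 4) secIdx := by
  funext z j
  fin_cases j <;> rfl

theorem fderiv_secMap (z : Jet 4) :
    fderiv ℝ secMap z = LinearMap.toContinuousLinearMap (coordMap (k := 4) secIdx) := by
  rw [secMap_eq]
  exact (LinearMap.toContinuousLinearMap (coordMap (k := 4) secIdx)).hasFDerivAt.fderiv

theorem surjective_fderiv_secMap (z : Jet 4) : Function.Surjective (fderiv ℝ secMap z) := by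
  intro y
  rw [fderiv_secMap]
  refine ⟨(0, ![![y 0, y 1, y 2, y 3], ![y 4, y 5, y 6, y 7], ![y 8, y 9, 0, y 10],
    ![y 11, y 12, 0, 0], ![y 13, 0, 0, 0]]), ?_⟩
  funext j
  fin_cases j <;> rfl

theorem excluded_eq {z : Jet 4} (hz : z ∈ secVariety) :
    excluded z = curv 2 (trunc 3 z) * phi z := by
  obtain ⟨a, b, c, p, q, r, h0, h1, h2, h3, h4⟩ := exists_of_mem_secVariety hz
  change _ = sympForm (z.2 2) (z.2 3) * _
  rw [phi_eq_phiJet, phiJet_eq, excluded, h1, h2, h3, h4]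
  simp [sympForm_apply, phiVal]
  ring

theorem secMap_infGen {z : Jet 4} {a b c p q r : ℝ} (h0 : z.2 0 = 0) (h1 : z.2 1 = ![1, 0, 0, 0])
    (h2 : z.2 2 = ![0, 1, a, 0]) (h3 : z.2 3 = ![0, 0, b, c]) (h4 : z.2 4 = ![0, p, q, r])
    (x : Fin 14 → ℝ) : secMap (infGen (lieElt x) z) =
      ![x 0, x 1, x 2, x 3, x 4, x 7, x 11, x 13, x 6 + x 8 * a, x 5 + x 10 * a,
        x 12 - x 6 * a, x 8 * b + x 10 * c, x 10 * b + x 9 * c, x 6 * p + x 8 * q + x 10 * r] := by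
  have e0 := infGen_zero x h0
  have e1 : (infGen (lieElt x) z).2 1 = _ := infGen_succ x z 0 h1
  have e2 : (infGen (lieElt x) z).2 2 = _ := infGen_succ x z 1 h2
  have e3 : (infGen (lieElt x) z).2 3 = _ := infGen_succ x z 2 h3
  have e4 : (infGen (lieElt x) z).2 4 = _ := infGen_succ x z 3 h4
  rw [secMap, e0, e1, e2, e3, e4]
  simp

/-- The equations being linear in the coordinates, this matrix represents the map from the Lie
algebra to ℝ¹⁴ that sends an element to the values of the equations on its generator. -/
theorem vecMul_transMatrix (z : Jet 4) (c : Fin 14 → ℝ) :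
    c ᵥ* transMatrix z = secMap (infGen (lieElt c) z) := by
  rw [← sum_smul_infGen, secMap_eq, map_sum]
  funext j
  simp [vecMul, dotProduct, transMatrix, fderiv_secMap]

theorem det_eq_of_row_eq_zero {n : ℕ} {R : Type*} [CommRing R]
    {M : Matrix (Fin (n + 1)) (Fin (n + 1)) R} (i j : Fin (n + 1)) (h : ∀ k ≠ j, M i k = 0) :
    M.det = (-1) ^ (i + j : ℕ) * M i j * (M.submatrix i.succAbove j.succAbove).det := by
  rw [Matrix.det_succ_row M i, Finset.sum_eq_single j]
  · intro k _ hk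
    rw [h k hk, mul_zero, zero_mul]
  · simp

theorem transMatrix_eq {z : Jet 4} {a b c p q r : ℝ} (h0 : z.2 0 = 0)
    (h1 : z.2 1 = ![1, 0, 0, 0])
    (h2 : z.2 2 = ![0, 1, a, 0]) (h3 : z.2 3 = ![0, 0, b, c]) (h4 : z.2 4 = ![0, p, q, r]) :
    transMatrix z =
    !![1, 0, 0, 0, 0, 0, 0, 0, 0, 0, 0, 0, 0, 0;
       0, 1, 0, 0, 0, 0, 0, 0, 0, 0, 0, 0, 0, 0;
       0, 0, 1, 0, 0, 0, 0, 0, 0, 0, 0, 0, 0, 0;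
       0, 0, 0, 1, 0, 0, 0, 0, 0, 0, 0, 0, 0, 0;
       0, 0, 0, 0, 1, 0, 0, 0, 0, 0, 0, 0, 0, 0;
       0, 0, 0, 0, 0, 0, 0, 0, 0, 1, 0, 0, 0, 0;
       0, 0, 0, 0, 0, 0, 0, 0, 1, 0, -a, 0, 0, p;
       0, 0, 0, 0, 0, 1, 0, 0, 0, 0, 0, 0, 0, 0;
       0, 0, 0, 0, 0, 0, 0, 0, a, 0, 0, b, 0, q;
       0, 0, 0, 0, 0, 0, 0, 0, 0, 0, 0, 0, c, 0;
       0, 0, 0, 0, 0, 0, 0, 0, 0, a, 0, c, b, r;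
       0, 0, 0, 0, 0, 0, 1, 0, 0, 0, 0, 0, 0, 0;
       0, 0, 0, 0, 0, 0, 0, 0, 0, 0, 1, 0, 0, 0;
       0, 0, 0, 0, 0, 0, 0, 1, 0, 0, 0, 0, 0, 0] := by
  have h : ∀ i, transMatrix z i = secMap (infGen (lieElt (Pi.single i 1)) z) := fun i => by
    rw [← vecMul_transMatrix, single_one_vecMul]
    rfl
  funext i
  rw [h, secMap_infGen h0 h1 h2 h3 h4]
  fin_cases i <;> simp <;> rfl

theorem det_transMatrix {z : Jet 4} (hz : z ∈ secVariety) : (transMatrix z).det = -excluded z := by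
  obtain ⟨a, b, c, p, q, r, h0, h1, h2, h3, h4⟩ := exists_of_mem_secVariety hz
  rw [transMatrix_eq h0 h1 h2 h3 h4]
  -- Eleven rows have a single relevant entry once the earlier pivots are removed. All these pivots
  -- are 1 except that of B₂², which is κ₂. The remaining 3 × 3 minor pairs A₁², B₁¹, B₁² with x⁽²⁾₁
  -- … replaced by the second component of order two and the first components of orders three and
  -- four; it gives the bracket in `excluded`.
  iterate 5 rw [det_eq_of_row_eq_zero 0 0
    (by intro k hk; fin_cases k <;> first | rfl | exact absurd rfl hk)]
  rw [det_eq_of_row_eq_zero 0 4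
    (by intro k hk; fin_cases k <;> first | rfl | exact absurd rfl hk)]
  rw [det_eq_of_row_eq_zero 1 0
    (by intro k hk; fin_cases k <;> first | rfl | exact absurd rfl hk)]
  rw [det_eq_of_row_eq_zero 2 5
    (by intro k hk; fin_cases k <;> first | rfl | exact absurd rfl hk)]
  rw [det_eq_of_row_eq_zero 3 0
    (by intro k hk; fin_cases k <;> first | rfl | exact absurd rfl hk)]
  rw [det_eq_of_row_eq_zero 3 2
    (by intro k hk; fin_cases k <;> first | rfl | exact absurd rfl hk)]
  rw [det_eq_of_row_eq_zero 3 0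
    (by intro k hk; fin_cases k <;> first | rfl | exact absurd rfl hk)]
  rw [Matrix.det_fin_three]
  rw [excluded, h2, h3, h4]
  simp [Fin.succAbove]
  ring

theorem coordMap_secIdx_infGen (z : Jet 4) (c : Fin 14 → ℝ) :
    coordMap (k := 4) secIdx (infGen (lieElt c) z) = c ᵥ* transMatrix z := by
  rw [vecMul_transMatrix, secMap_eq]

theorem isCompl_of_det_transMatrix_ne_zero {z : Jet 4} (h : (transMatrix z).det ≠ 0) :
    IsCompl (LinearMap.ker (coordMap (k := 4) secIdx)) (orbitTangent z) := by
  have hu := (Matrix.isUnit_iff_isUnit_det _).2 (isUnit_iff_ne_zero.2 h)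
  refine isCompl_ker_orbitTangent (fun c hc => ?_) fun y => ?_
  · rw [coordMap_secIdx_infGen] at hc
    have : c = 0 := Matrix.vecMul_injective_of_isUnit hu (hc.trans (zero_vecMul _).symm)
    rw [this, ← sum_smul_infGen]
    simp
  · obtain ⟨c, hc⟩ := Matrix.vecMul_surjective_iff_isUnit.2 hu y
    exact ⟨c, (coordMap_secIdx_infGen z c).trans hc⟩

theorem isCompl_iff_excluded_ne_zero {z : Jet 4} (hz : z ∈ secVariety) :
    IsCompl (LinearMap.ker (fderiv ℝ secMap z).toLinearMap) (orbitTangent z) ↔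
      excluded z ≠ 0 := by
  rw [← neg_ne_zero, ← det_transMatrix hz]
  have hker : (fderiv ℝ secMap z).toLinearMap = coordMap (k := 4) secIdx := by
    rw [fderiv_secMap]
    rfl
  rw [hker]
  refine ⟨fun h => ?_, isCompl_of_det_transMatrix_ne_zero⟩
  rw [← isUnit_iff_ne_zero, ← Matrix.isUnit_iff_isUnit_det, ← Matrix.vecMul_surjective_iff_isUnit]
  -- The equations form a submersion and their kernel together with the orbit directions spans
  -- everything, so every value is already attained on an orbit direction.
  intro y
  obtain ⟨u, hu⟩ := surjective_fderiv_secMap z y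
  obtain ⟨k, hk, v, hv, rfl⟩ := Submodule.mem_sup.1 (h.sup_eq_top ▸ Submodule.mem_top (x := u))
  obtain ⟨c, rfl⟩ := mem_orbitTangent.1 hv
  refine ⟨c, ?_⟩
  change c ᵥ* transMatrix z = y
  rw [← coordMap_secIdx_infGen, ← hu, fderiv_secMap]
  change _ = coordMap (k := 4) secIdx (k + _)
  rw [map_add, LinearMap.mem_ker.1 hk, zero_add]

/-! ### The projections of the cross-section -/

/-- A fourth order completion of every admissible third order part, with φ = -c. Hence φ ≠ 0 imposes
nothing on the projections to lower order; only κ₂ ≠ 0 survives, and only at order three. -/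
theorem mem_crossSec_of_third_order (t a b : ℝ) {c : ℝ} (hc : c ≠ 0) :
    ((t, ![0, ![1, 0, 0, 0], ![0, 1, a, 0], ![0, 0, b, c], ![0, 0, 1, 0]]) : Jet 4) ∈ crossSec := by
  refine ⟨?_, mem_regJets.2 ⟨?_, ?_⟩⟩
  · simp [secVariety, secMap, secVal]
  · simpa [sympForm_apply]
  · rw [phi_eq_phiJet, phiJet_eq]
    simp [sympForm_apply, phiVal]
    exact fun h => hc (by linear_combination -h)

theorem trunc_zero_image :
    (fun w : Jet 4 => trunc 0 w) '' crossSec = {w | w.2 0 = 0} := by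
  ext w
  constructor
  · rintro ⟨z, hz, rfl⟩
    obtain ⟨a, b, c, p, q, r, h0, h1, h2, h3, h4⟩ := exists_of_mem_secVariety hz.1
    exact h0
  · intro h0
    refine ⟨_, mem_crossSec_of_third_order w.1 0 0 one_ne_zero,
      Prod.ext rfl (funext fun i => ?_)⟩
    fin_cases i
    exact h0.symm

theorem trunc_one_image :
    (fun w : Jet 4 => trunc 1 w) '' crossSec = {w | w.2 0 = 0 ∧ w.2 1 = ![1, 0, 0, 0]} := by
  ext w
  constructor
  · rintro ⟨z, hz, rfl⟩
    obtain ⟨a, b, c, p, q, r, h0, h1, h2, h3, h4⟩ := exists_of_mem_secVariety hz.1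
    exact ⟨h0, h1⟩
  · rintro ⟨h0, h1⟩
    refine ⟨_, mem_crossSec_of_third_order w.1 0 0 one_ne_zero,
      Prod.ext rfl (funext fun i => ?_)⟩
    fin_cases i
    · exact h0.symm
    · exact h1.symm

theorem trunc_two_image : (fun w : Jet 4 => trunc 2 w) '' crossSec =
    {w | w.2 0 = 0 ∧ w.2 1 = ![1, 0, 0, 0] ∧ ∃ a, w.2 2 = ![0, 1, a, 0]} := by
  ext w
  constructor
  · rintro ⟨z, hz, rfl⟩
    obtain ⟨a, b, c, p, q, r, h0, h1, h2, h3, h4⟩ := exists_of_mem_secVariety hz.1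
    exact ⟨h0, h1, a, h2⟩
  · rintro ⟨h0, h1, a, h2⟩
    refine ⟨_, mem_crossSec_of_third_order w.1 a 0 one_ne_zero,
      Prod.ext rfl (funext fun i => ?_)⟩
    fin_cases i
    · exact h0.symm
    · exact h1.symm
    · exact h2.symm

theorem trunc_three_image : (fun w : Jet 4 => trunc 3 w) '' crossSec =
    {w | w.2 0 = 0 ∧ w.2 1 = ![1, 0, 0, 0] ∧ (∃ a, w.2 2 = ![0, 1, a, 0]) ∧
      ∃ b c, c ≠ 0 ∧ w.2 3 = ![0, 0, b, c]} := by
  ext w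
  constructor
  · rintro ⟨z, hz, rfl⟩
    obtain ⟨a, b, c, p, q, r, h0, h1, h2, h3, h4⟩ := exists_of_mem_secVariety hz.1
    have hk := (mem_regJets.1 hz.2).1
    rw [h2, h3] at hk
    exact ⟨h0, h1, ⟨a, h2⟩, b, c, by simpa [sympForm_apply] using hk, h3⟩
  · rintro ⟨h0, h1, ⟨a, h2⟩, b, c, hc, h3⟩
    refine ⟨_, mem_crossSec_of_third_order w.1 a b hc, Prod.ext rfl (funext fun i => ?_)⟩
    fin_cases i
    · exact h0.symm
    · exact h1.symm
    · exact h2.symm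
    · exact h3.symm

theorem isLocalCrossSectionAt_zero {z : Jet 0} (hz : z.2 0 = 0) :
    IsLocalCrossSectionAt {w : Jet 0 | w.2 0 = 0} z := by
  refine isLocalCrossSectionAt_of_linear (U := univ)
    (coordMap ![(0, 0), (0, 1), (0, 2), (0, 3)]) 0 hz (mem_univ _) isOpen_univ ?_ ?_ ?_
  · ext w
    simp [coordMap, funext_iff, Fin.forall_fin_succ]
  · rintro w ⟨hw, -⟩ c hc
    refine Prod.ext rfl (funext fun i => ?_)
    fin_cases i
    refine (infGen_zero c hw).trans ?_
    have e0 := infGen_zero c hw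
    simp [coordMap, funext_iff, Fin.forall_fin_succ, e0] at hc
    simp [hc]
  · rintro w ⟨hw, -⟩ y
    refine ⟨![y 0, y 1, y 2, y 3, 0, 0, 0, 0, 0, 0, 0, 0, 0, 0], ?_⟩
    funext j
    fin_cases j <;> simp [coordMap, infGen_zero _ hw]

theorem isLocalCrossSectionAt_one {z : Jet 1} (hz : z.2 0 = 0 ∧ z.2 1 = ![1, 0, 0, 0]) :
    IsLocalCrossSectionAt {w : Jet 1 | w.2 0 = 0 ∧ w.2 1 = ![1, 0, 0, 0]} z := by
  refine isLocalCrossSectionAt_of_linear (U := univ)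
    (coordMap ![(0, 0), (0, 1), (0, 2), (0, 3), (1, 0), (1, 1), (1, 2), (1, 3)])
    ![0, 0, 0, 0, 1, 0, 0, 0] hz (mem_univ _) isOpen_univ ?_ ?_ ?_
  · ext w
    simp [coordMap, funext_iff, Fin.forall_fin_succ]
    tauto
  · rintro w ⟨⟨h0, h1⟩, -⟩ c hc
    have e0 := infGen_zero c h0
    have e1 : (infGen (lieElt c) w).2 1 = _ := infGen_succ c w 0 h1
    simp [coordMap, funext_iff, Fin.forall_fin_succ, e0, e1] at hc
    refine Prod.ext rfl (funext fun i => ?_)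
    fin_cases i
    · exact e0.trans (by simp [hc])
    · exact e1.trans (by simp [hc])
  · rintro w ⟨⟨h0, h1⟩, -⟩ y
    refine ⟨![y 0, y 1, y 2, y 3, y 4, 0, 0, y 5, 0, 0, 0, y 6, 0, y 7], ?_⟩
    have e1 : ∀ c, (infGen (lieElt c) w).2 1 = _ := fun c => infGen_succ c w 0 h1
    funext j
    fin_cases j <;> simp [coordMap, infGen_zero _ h0, e1]

theorem isLocalCrossSectionAt_two {z : Jet 2}
    (hz : z.2 0 = 0 ∧ z.2 1 = ![1, 0, 0, 0] ∧ ∃ a, z.2 2 = ![0, 1, a, 0]) :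
    IsLocalCrossSectionAt
      {w : Jet 2 | w.2 0 = 0 ∧ w.2 1 = ![1, 0, 0, 0] ∧ ∃ a, w.2 2 = ![0, 1, a, 0]} z := by
  refine isLocalCrossSectionAt_of_linear (U := univ)
    (coordMap ![(0, 0), (0, 1), (0, 2), (0, 3), (1, 0), (1, 1), (1, 2), (1, 3),
      (2, 0), (2, 1), (2, 3)])
    ![0, 0, 0, 0, 1, 0, 0, 0, 0, 1, 0] hz (mem_univ _) isOpen_univ ?_ ?_ ?_
  · ext w
    simp [coordMap, funext_iff, Fin.forall_fin_succ]
    tauto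
  · rintro w ⟨⟨h0, h1, a, h2⟩, -⟩ c hc
    have e0 := infGen_zero c h0
    have e1 : (infGen (lieElt c) w).2 1 = _ := infGen_succ c w 0 h1
    have e2 : (infGen (lieElt c) w).2 2 = _ := infGen_succ c w 1 h2
    simp [coordMap, funext_iff, Fin.forall_fin_succ, e0, e1, e2] at hc
    refine Prod.ext rfl (funext fun i => ?_)
    fin_cases i
    · exact e0.trans (by simp [hc])
    · exact e1.trans (by simp [hc])
    · exact e2.trans (by simp [hc])
  · rintro w ⟨⟨h0, h1, a, h2⟩, -⟩ y
    refine ⟨![y 0, y 1, y 2, y 3, y 4, y 9, y 8, y 5, 0, 0, 0, y 6, y 10 + y 8 * a, y 7], ?_⟩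
    have e1 : ∀ c, (infGen (lieElt c) w).2 1 = _ := fun c => infGen_succ c w 0 h1
    have e2 : ∀ c, (infGen (lieElt c) w).2 2 = _ := fun c => infGen_succ c w 1 h2
    funext j
    fin_cases j <;> simp [coordMap, infGen_zero _ h0, e1, e2]

theorem isLocalCrossSectionAt_three {z : Jet 3}
    (hz : z.2 0 = 0 ∧ z.2 1 = ![1, 0, 0, 0] ∧ (∃ a, z.2 2 = ![0, 1, a, 0]) ∧
      ∃ b c, c ≠ 0 ∧ z.2 3 = ![0, 0, b, c]) :
    IsLocalCrossSectionAt {w : Jet 3 | w.2 0 = 0 ∧ w.2 1 = ![1, 0, 0, 0] ∧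
      (∃ a, w.2 2 = ![0, 1, a, 0]) ∧ ∃ b c, c ≠ 0 ∧ w.2 3 = ![0, 0, b, c]} z := by
  refine isLocalCrossSectionAt_of_linear (U := {w | w.2 3 3 ≠ 0})
    (coordMap ![(0, 0), (0, 1), (0, 2), (0, 3), (1, 0), (1, 1), (1, 2), (1, 3),
      (2, 0), (2, 1), (2, 3), (3, 0), (3, 1)])
    ![0, 0, 0, 0, 1, 0, 0, 0, 0, 1, 0, 0, 0] hz ?_
    (isOpen_ne_fun (contDiff_coord (k := 3) 3 3 (n := 0)).continuous continuous_const) ?_ ?_ ?_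
  · obtain ⟨-, -, -, b, c, hc, h3⟩ := hz
    simpa [h3] using hc
  · ext w
    simp only [mem_inter_iff, mem_ofPred_eq]
    rw [and_comm]
    refine and_congr_right fun hw => ?_
    simp [coordMap, funext_iff, Fin.forall_fin_succ]
    tauto
  · rintro w ⟨⟨h0, h1, ⟨a, h2⟩, b, d, hd, h3⟩, -⟩ c hc
    have e0 := infGen_zero c h0
    have e1 : (infGen (lieElt c) w).2 1 = _ := infGen_succ c w 0 h1
    have e2 : (infGen (lieElt c) w).2 2 = _ := infGen_succ c w 1 h2
    have e3 : (infGen (lieElt c) w).2 3 = _ := infGen_succ c w 2 h3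
    simp [coordMap, funext_iff, Fin.forall_fin_succ, e0, e1, e2, e3] at hc
    -- The last component of order three is not among the equations. That it does not vary follows
    -- from those of orders two and three, in accordance with the invariance of κ₂.
    have h33 : c 6 * b + c 5 * d = 0 := by
      obtain ⟨-, -, -, -, -, -, -, -, k6, k5, -, k8, -⟩ := hc
      linear_combination b * k6 + d * k5 - a * k8
    refine Prod.ext rfl (funext fun i => ?_)
    fin_cases i
    · exact e0.trans (by simp [hc])
    · exact e1.trans (by simp [hc])
    · exact e2.trans (by simp [hc])
    · refine e3.trans ?_
      simp [hc]
      linarith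
  · rintro w ⟨⟨h0, h1, ⟨a, h2⟩, b, d, hd, h3⟩, -⟩ y
    -- With the coordinate along B₁¹ set to 0 the system is triangular. Its pivots are 1 except for
    -- two equal to d = κ₂, which belong to B₁² and B₂².
    refine ⟨![y 0, y 1, y 2, y 3, y 4, y 9 - y 11 / d * a, y 8, y 5, 0,
      (y 12 - y 11 / d * b) / d, y 11 / d, y 6, y 10 + y 8 * a, y 7], ?_⟩
    have e1 : ∀ c, (infGen (lieElt c) w).2 1 = _ := fun c => infGen_succ c w 0 h1
    have e2 : ∀ c, (infGen (lieElt c) w).2 2 = _ := fun c => infGen_succ c w 1 h2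
    have e3 : ∀ c, (infGen (lieElt c) w).2 3 = _ := fun c => infGen_succ c w 2 h3
    funext j
    fin_cases j <;> simp [coordMap, infGen_zero _ h0, e1, e2, e3, hd]

theorem isLocalCrossSectionAt_crossSec {z : Jet 4} (hz : z ∈ crossSec) :
    IsLocalCrossSectionAt crossSec z := by
  refine ⟨hz, 14, fun w => secMap w - secVal, regJets, isOpen_regJets, hz.2, ?_, ?_,
    fun w hw => ?_⟩
  · rw [secMap_eq]
    exact ((LinearMap.toContinuousLinearMap (coordMap (k := 4) secIdx)).contDiff.sub
      contDiff_const).contDiffOn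
  · ext w
    simp [crossSec, secVariety, sub_eq_zero, and_comm]
  · rw [fderiv_sub_const]
    refine ⟨surjective_fderiv_secMap w, (isCompl_iff_excluded_ne_zero hw.1.1).2 ?_⟩
    rw [excluded_eq hw.1.1]
    exact hw.1.2

theorem isMinimalOrderCrossSection_crossSec : IsMinimalOrderCrossSection crossSec := by
  intro k hk z hz
  interval_cases k
  · have h := trunc_zero_image
    rw [h] at hz ⊢
    exact isLocalCrossSectionAt_zero hz
  · have h := trunc_one_image
    rw [h] at hz ⊢
    exact isLocalCrossSectionAt_one hz
  · have h := trunc_two_image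
    rw [h] at hz ⊢
    exact isLocalCrossSectionAt_two hz
  · have h := trunc_three_image
    rw [h] at hz ⊢
    exact isLocalCrossSectionAt_three hz
  · have h : (fun w : Jet 4 => trunc 4 w hk) '' crossSec = crossSec := image_id crossSec
    rw [h] at hz ⊢
    exact isLocalCrossSectionAt_crossSec hz

/-! ### The Maurer–Cartan form modulo contact forms -/

/-- The line through `z` in direction `v`, projected to `J⁴`, meets the hypotheses of
`hasDerivAt_frame` exactly because `v` is a contact vector, with c = `v.1`. The order five component
of `v` plays no role, since the frame depends on the 4-jet only. -/
theorem pullbackMC_frame {z v : Jet 5} (hz : trunc 4 z ∈ regJets) (hv : IsContactVector z v) :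
    pullbackMC frame z v = -(v.1 • frenetJet z) := by
  have hu : IsUnit (frame (trunc 4 z)).det := isUnit_det_of_mem_affSp (frame_mem_affSp hz)
  have hd : ∀ i j, fderiv ℝ (fun w : Jet 5 => frame (trunc 4 w) i j) z v =
      (-(v.1 • frenetJet z) * frame (trunc 4 z)) i j := by
    intro i j
    have h1 : DifferentiableAt ℝ (fun z => frame z i j) (trunc 4 z) :=
      ((contDiffOn_frame i j).contDiffAt (isOpen_regJets.mem_nhds hz)).differentiableAt (by simp)
    have h2 : DifferentiableAt ℝ (fun w : Jet 5 => (trunc 4 w : Jet 4)) z := by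
      unfold trunc
      fun_prop
    have h3 : DifferentiableAt ℝ (fun w : Jet 5 => frame (trunc 4 w) i j) z :=
      DifferentiableAt.comp (g := fun z => frame z i j) (f := fun w : Jet 5 => trunc 4 w) z h1 h2
    rw [← h3.lineDeriv_eq_fderiv, lineDeriv]
    have h4 := hasDerivAt_frame (w := fun s : ℝ => trunc 4 (z + s • v)) (t := 0) (c := v.1) hz
      (by simp) ((differentiableAt_id.smul_const v.1).const_add z.1)
      (fun i => by
        have := ((hasDerivAt_id (0 : ℝ)).smul_const (v.2 i.castSucc)).const_add (z.2 i.castSucc)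
        rw [one_smul, hv i] at this
        refine this.congr_of_eventuallyEq (Filter.Eventually.of_forall fun s => ?_)
        change z.2 i.castSucc + s • v.2 i.castSucc = _
        rw [hv i]
        rfl) i j
    simpa using h4.deriv
  have hM : (Matrix.of fun i j => fderiv ℝ (fun w : Jet 5 => frame (trunc 4 w) i j) z v) =
      -(v.1 • frenetJet z) * frame (trunc 4 z) := by
    ext i j
    exact hd i j
  rw [pullbackMC, hM, Matrix.mul_assoc, Matrix.mul_nonsing_inv _ hu, Matrix.mul_one]

/-! ### Jets of curves -/

section Curves

variable {I : Set ℝ} {γ : ℝ → Fin 4 → ℝ}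

theorem contDiffOn_iteratedDeriv (hI : IsOpen I) (hγ : ContDiffOn ℝ ∞ γ I) (n : ℕ) :
    ContDiffOn ℝ ∞ (iteratedDeriv n γ) I := by
  induction n with
  | zero => rwa [iteratedDeriv_zero]
  | succ n ih =>
    rw [iteratedDeriv_succ]
    exact ((contDiffOn_infty_iff_deriv_of_isOpen hI).1 ih).2

theorem hasDerivAt_iteratedDeriv (hI : IsOpen I) (hγ : ContDiffOn ℝ ∞ γ I) (n : ℕ) {t : ℝ}
    (ht : t ∈ I) : HasDerivAt (iteratedDeriv n γ) (iteratedDeriv (n + 1) γ t) t := by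
  rw [iteratedDeriv_succ]
  exact (((contDiffOn_iteratedDeriv hI hγ n).contDiffAt (hI.mem_nhds ht)).differentiableAt
    (by simp)).hasDerivAt

theorem hasDerivAt_sympForm_iteratedDeriv (hI : IsOpen I) (hγ : ContDiffOn ℝ ∞ γ I) (i j : ℕ)
    {t : ℝ} (ht : t ∈ I) :
    HasDerivAt (fun s => sympForm (iteratedDeriv i γ s) (iteratedDeriv j γ s))
      (sympForm (iteratedDeriv (i + 1) γ t) (iteratedDeriv j γ t) +
        sympForm (iteratedDeriv i γ t) (iteratedDeriv (j + 1) γ t)) t :=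
  (hasDerivAt_iteratedDeriv hI hγ i ht).sympForm (hasDerivAt_iteratedDeriv hI hγ j ht)

theorem contDiffOn_curveCurv (hI : IsOpen I) (hγ : ContDiffOn ℝ ∞ γ I) (i : ℕ) :
    ContDiffOn ℝ ∞ (curveCurv i γ) I := by
  have h : ∀ n a, ContDiffOn ℝ ∞ (fun t => iteratedDeriv n γ t a) I := fun n a =>
    contDiffOn_pi.1 (contDiffOn_iteratedDeriv hI hγ n) a
  have : curveCurv i γ = fun t => sympForm (iteratedDeriv i γ t) (iteratedDeriv (i + 1) γ t) := rfl
  rw [this]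
  simp only [sympForm_apply]
  exact ((((h _ _).mul (h _ _)).add ((h _ _).mul (h _ _))).sub ((h _ _).mul (h _ _))).sub
    ((h _ _).mul (h _ _))

theorem eqOn_deriv {f g : ℝ → ℝ} (hI : IsOpen I) (h : EqOn f g I) : EqOn (deriv f) (deriv g) I :=
  fun _ ht => (h.eventuallyEq_of_mem (hI.mem_nhds ht)).deriv_eq

theorem deriv_curveCurv (hI : IsOpen I) (hγ : ContDiffOn ℝ ∞ γ I) (i : ℕ) {t : ℝ} (ht : t ∈ I) :
    deriv (curveCurv i γ) t = sympForm (iteratedDeriv i γ t) (iteratedDeriv (i + 2) γ t) := by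
  have := (hasDerivAt_sympForm_iteratedDeriv hI hγ i (i + 1) ht).deriv
  rw [sympForm_self, zero_add] at this
  exact this

theorem deriv_deriv_curveCurv (hI : IsOpen I) (hγ : ContDiffOn ℝ ∞ γ I) (i : ℕ) {t : ℝ}
    (ht : t ∈ I) : deriv (deriv (curveCurv i γ)) t =
      sympForm (iteratedDeriv (i + 1) γ t) (iteratedDeriv (i + 2) γ t) +
      sympForm (iteratedDeriv i γ t) (iteratedDeriv (i + 3) γ t) :=
  (eqOn_deriv hI (fun _ hs => deriv_curveCurv hI hγ i hs) ht).trans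
    (hasDerivAt_sympForm_iteratedDeriv hI hγ i (i + 2) ht).deriv

theorem normJet_jet (hI : IsOpen I) (hγ : ContDiffOn ℝ ∞ γ I) {t : ℝ} (ht : t ∈ I) :
    normJet (jet 4 γ t) = normOf (curveCurv 1 γ) (curveCurv 2 γ) (curveCurv 3 γ) t := by
  rw [normJet_eq, normOf, deriv_deriv_curveCurv hI hγ 1 ht, deriv_curveCurv hI hγ 1 ht,
    deriv_curveCurv hI hγ 2 ht]
  rfl

theorem phi_jet (hI : IsOpen I) (hγ : ContDiffOn ℝ ∞ γ I) {t : ℝ} (ht : t ∈ I) :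
    phi (jet 4 γ t) = phiOf (curveCurv 1 γ) (curveCurv 2 γ) (curveCurv 3 γ) t := by
  rw [phi_eq_phiJet, phiJet_eq, phiOf, deriv_deriv_curveCurv hI hγ 1 ht,
    deriv_curveCurv hI hγ 1 ht, deriv_curveCurv hI hγ 2 ht]
  rfl

theorem frenetJet_jet (hI : IsOpen I) (hγ : ContDiffOn ℝ ∞ γ I) {t : ℝ} (ht : t ∈ I) :
    frenetJet (jet 5 γ t) =
      frenetOf (curveCurv 1 γ) (curveCurv 2 γ) (curveCurv 3 γ) (curveCurv 4 γ) t := by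
  have hφ : phi (trunc 4 (jet 5 γ t)) = _ := phi_jet hI hγ ht
  rw [frenetJet_eq, tauJet_eq, hφ, frenetOf, tauOf, deriv_deriv_curveCurv hI hγ 2 ht,
    deriv_curveCurv hI hγ 1 ht, deriv_curveCurv hI hγ 2 ht, deriv_curveCurv hI hγ 3 ht]
  rfl

theorem hasMCForm_frame_jet (hI : IsOpen I) (hγ : ContDiffOn ℝ ∞ γ I)
    (hreg : ∀ t ∈ I, jet 4 γ t ∈ regJets) :
    HasMCForm I (frenetOf (curveCurv 1 γ) (curveCurv 2 γ) (curveCurv 3 γ) (curveCurv 4 γ))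
      (fun t => frame (jet 4 γ t)) := by
  intro t ht
  refine ⟨frame_mem_affSp (hreg t ht), fun i j => ?_⟩
  have h := hasDerivAt_frame (w := jet 4 γ) (z := jet 5 γ t) (c := 1) (t := t) (hreg t ht) rfl
    differentiableAt_id (fun i => by
      rw [one_smul]
      exact hasDerivAt_iteratedDeriv hI hγ i ht) i j
  rwa [one_smul, frenetJet_jet hI hγ ht] at h

theorem mem_regJets_jet (hI : IsOpen I) (hγ : ContDiffOn ℝ ∞ γ I) {t : ℝ} (ht : t ∈ I) :
    jet 4 γ t ∈ regJets ↔ curveCurv 2 γ t ≠ 0 ∧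
      phiOf (curveCurv 1 γ) (curveCurv 2 γ) (curveCurv 3 γ) t ≠ 0 := by
  rw [mem_regJets, phi_jet hI hγ ht]
  rfl

theorem linearIndependent_jet_iff (t : ℝ) : LinearIndependent ℝ
    ![iteratedDeriv 1 γ t, iteratedDeriv 2 γ t, iteratedDeriv 3 γ t, iteratedDeriv 4 γ t] ↔
      phi (jet 4 γ t) ≠ 0 := by
  have h : phi (jet 4 γ t) = Matrix.det (Matrix.of
      ![iteratedDeriv 1 γ t, iteratedDeriv 2 γ t, iteratedDeriv 3 γ t, iteratedDeriv 4 γ t]) := by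
    rw [← Matrix.det_transpose, phi]
    congr 1
    ext a c
    fin_cases c <;> rfl
  rw [h, ← isUnit_iff_ne_zero, ← Matrix.isUnit_iff_isUnit_det,
    ← Matrix.linearIndependent_rows_iff_isUnit]
  rfl

/-- Along a Lagrangian curve, `φ = κ₂²`. -/
theorem IsLagrangian.phi_eq (hI : IsOpen I) (hγ : IsLagrangian I γ) {t : ℝ} (ht : t ∈ I) :
    phi (jet 4 γ t) = curveCurv 2 γ t ^ 2 := by
  have h0 : EqOn (curveCurv 1 γ) (fun _ => 0) I := fun s hs => (hγ.2 s hs).2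
  have h1 : EqOn (deriv (curveCurv 1 γ)) (fun _ => 0) I := fun s hs => by
    rw [eqOn_deriv hI h0 hs, deriv_const]
  have h2 : deriv (deriv (curveCurv 1 γ)) t = 0 := by
    rw [eqOn_deriv hI h1 ht, deriv_const]
  rw [phi_jet hI hγ.1 ht, phiOf, h0 ht, h1 ht, h2, phiVal]
  ring

theorem IsLagrangian.mem_regJets_iff (hI : IsOpen I) (hγ : IsLagrangian I γ) {t : ℝ}
    (ht : t ∈ I) : jet 4 γ t ∈ regJets ↔ curveCurv 2 γ t ≠ 0 := by
  rw [mem_regJets, hγ.phi_eq hI ht]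
  exact ⟨fun h => h.1, fun h => ⟨h, pow_ne_zero _ h⟩⟩

theorem IsLagrangian.isLinearlyFull_iff (hI : IsOpen I) (hγ : IsLagrangian I γ) :
    IsLinearlyFull I γ ↔ ∀ t ∈ I, jet 4 γ t ∈ regJets := by
  refine forall₂_congr fun t ht => ?_
  rw [linearIndependent_jet_iff, hγ.phi_eq hI ht, hγ.mem_regJets_iff hI ht]
  exact pow_ne_zero_iff two_ne_zero

end Curves

/-! ### Smoothness of the Serret–Frenet matrix -/

section Data

variable {I : Set ℝ} {k1 k2 k3 k4 : ℝ → ℝ}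

theorem contDiffOn_deriv {f : ℝ → ℝ} (hI : IsOpen I) (hf : ContDiffOn ℝ ∞ f I) :
    ContDiffOn ℝ ∞ (deriv f) I :=
  ((contDiffOn_infty_iff_deriv_of_isOpen hI).1 hf).2

theorem contDiffOn_phiOf (hI : IsOpen I) (h1 : ContDiffOn ℝ ∞ k1 I) (h2 : ContDiffOn ℝ ∞ k2 I)
    (h3 : ContDiffOn ℝ ∞ k3 I) : ContDiffOn ℝ ∞ (phiOf k1 k2 k3) I := by
  have d1 := contDiffOn_deriv hI h1
  have dd1 := contDiffOn_deriv hI d1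
  have d2 := contDiffOn_deriv hI h2
  exact (((h2.pow 2).sub (h1.mul h3)).add (d1.mul d2)).sub (h2.mul dd1)

theorem contDiffOn_tauOf (hI : IsOpen I) (h1 : ContDiffOn ℝ ∞ k1 I) (h2 : ContDiffOn ℝ ∞ k2 I)
    (h3 : ContDiffOn ℝ ∞ k3 I) (h4 : ContDiffOn ℝ ∞ k4 I) (hφ : ∀ t ∈ I, phiOf k1 k2 k3 t ≠ 0) :
    ContDiffOn ℝ ∞ (tauOf k1 k2 k3 k4) I := by
  have d2 := contDiffOn_deriv hI h2
  have dd2 := contDiffOn_deriv hI d2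
  have d3 := contDiffOn_deriv hI h3
  have p2 := (contDiffOn_phiOf hI h1 h2 h3).pow 2
  have hp : ∀ t ∈ I, phiOf k1 k2 k3 t ^ 2 ≠ 0 := fun t ht => pow_ne_zero _ (hφ t ht)
  exact (((((h2.pow 2).div p2 hp).mul h4).sub (((h2.mul d2).div p2 hp).mul d3)).add
    (((h2.mul h3).div p2 hp).mul dd2)).sub ((h2.mul (h3.pow 2)).div p2 hp)

theorem contDiffOn_frenetOf (hI : IsOpen I) (h1 : ContDiffOn ℝ ∞ k1 I) (h2 : ContDiffOn ℝ ∞ k2 I)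
    (h3 : ContDiffOn ℝ ∞ k3 I) (h4 : ContDiffOn ℝ ∞ k4 I) (h0 : ∀ t ∈ I, k2 t ≠ 0)
    (hφ : ∀ t ∈ I, phiOf k1 k2 k3 t ≠ 0) (i j : Fin 5) :
    ContDiffOn ℝ ∞ (fun t => frenetOf k1 k2 k3 k4 t i j) I := by
  have d1 := contDiffOn_deriv hI h1
  have hτ := contDiffOn_tauOf hI h1 h2 h3 h4 hφ
  fin_cases i <;> fin_cases j <;> first
    | exact contDiffOn_const
    | exact h1
    | exact h1.mul hτ
    | exact hτ.neg
    | exact (d1.mul hτ).div h2 h0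
    | exact (((h1.mul d1).mul hτ).div h2 h0).neg
    | exact ((((d1.pow 2).mul hτ).add h3).div (h2.pow 2) fun t ht => pow_ne_zero _ (h0 t ht)).neg
    | exact h2.add ((h1.pow 2).mul hτ)
    | exact (h1.mul hτ).neg
    | exact ((h1.mul d1).mul hτ).div h2 h0

end Data

/-! ### Curves in the group with given Maurer–Cartan form -/

section MCForm

variable {I : Set ℝ} {M : ℝ → Matrix (Fin 5) (Fin 5) ℝ}

/-- Matrices as continuous linear maps, linearly. -/
def matrixCLM (ι : Type*) [Fintype ι] [DecidableEq ι] :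
    Matrix ι ι ℝ →ₗ[ℝ] ((ι → ℝ) →L[ℝ] (ι → ℝ)) :=
  LinearMap.toContinuousLinearMap.toLinearMap ∘ₗ Matrix.toLin'.toLinearMap

theorem continuousOn_matrixCLM {ι : Type*} [Fintype ι] [DecidableEq ι] {M : ℝ → Matrix ι ι ℝ}
    (hM : ∀ i j, ContinuousOn (fun t => M t i j) I) :
    ContinuousOn (fun t => matrixCLM ι (M t)) I :=
  (LinearMap.continuous_of_finiteDimensional (matrixCLM ι)).comp_continuousOn
    (continuousOn_pi.2 fun i => continuousOn_pi.2 fun j => hM i j)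

theorem matrix_ode_unique {ι : Type*} [Fintype ι] [DecidableEq ι] {M : ℝ → Matrix ι ι ℝ}
    (hI : I.OrdConnected) (hM : ∀ i j, ContinuousOn (fun t => M t i j) I) {R S : ℝ → Matrix ι ι ℝ}
    (hR : ∀ t ∈ I, ∀ i j, HasDerivAt (fun s => R s i j) ((M t * R t) i j) t)
    (hS : ∀ t ∈ I, ∀ i j, HasDerivAt (fun s => S s i j) ((M t * S t) i j) t)
    {t₀ t : ℝ} (ht₀ : t₀ ∈ I) (h : R t₀ = S t₀) (ht : t ∈ I) : R t = S t := by
  have key : ∀ j, (fun i => R t i j) = fun i => S t i j := fun j =>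
    linear_ode_unique (α := fun s i => R s i j) (β := fun s i => S s i j) hI
      (continuousOn_matrixCLM hM) ht₀
      (fun s hs => (hasDerivAt_pi.2 fun i => hR s hs i j).hasDerivWithinAt)
      (fun s hs => (hasDerivAt_pi.2 fun i => hS s hs i j).hasDerivWithinAt)
      (by rw [h]) ht
  ext i j
  exact congrFun (key j) i

theorem exists_matrix_ode {ι : Type*} [Fintype ι] [DecidableEq ι] {M : ℝ → Matrix ι ι ℝ}
    (hI : IsOpen I) (hIc : I.OrdConnected) (hM : ∀ i j, ContinuousOn (fun t => M t i j) I) {t₀ : ℝ}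
    (ht₀ : t₀ ∈ I) : ∃ R : ℝ → Matrix ι ι ℝ, R t₀ = 1 ∧
      ∀ t ∈ I, ∀ i j, HasDerivAt (fun s => R s i j) ((M t * R t) i j) t := by
  have h : ∀ j, ∃ α : ℝ → ι → ℝ, (α t₀ = fun i => (1 : Matrix ι ι ℝ) i j) ∧
      ∀ t ∈ I, HasDerivAt α (matrixCLM ι (M t) (α t)) t := fun j =>
    exists_hasDerivAt_linear hI hIc ht₀ (continuousOn_matrixCLM hM) _
  choose α h0 hα using h
  refine ⟨fun t => Matrix.of fun i j => α j t i, ?_, fun t ht i j => hasDerivAt_pi.1 (hα j t ht) i⟩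
  ext i j
  exact congrFun (h0 j) i

/-- Right multiplication by a constant commutes with left multiplication by -M, so R · R(t₀)⁻¹R'(t₀)
solves the equation of R' with the same value at t₀. -/
theorem exists_eq_mul_of_hasMCForm (hI : I.OrdConnected)
    (hM : ∀ i j, ContinuousOn (fun t => M t i j) I) {R R' : ℝ → Matrix (Fin 5) (Fin 5) ℝ}
    (hR : HasMCForm I M R) (hR' : HasMCForm I M R') : ∃ g ∈ affSp, ∀ t ∈ I, R' t = R t * g := by
  rcases I.eq_empty_or_nonempty with rfl | ⟨t₀, ht₀⟩
  · exact ⟨1, one_mem_affSp, fun t ht => ht.elim⟩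
  have h0 := (hR t₀ ht₀).1
  refine ⟨(R t₀)⁻¹ * R' t₀, mul_mem_affSp (inv_mem_affSp h0) (hR' t₀ ht₀).1, fun t ht => ?_⟩
  refine matrix_ode_unique (M := fun t => -(M t)) hI (fun i j => (hM i j).neg)
    (fun t ht => (hR' t ht).2) (S := fun t => R t * ((R t₀)⁻¹ * R' t₀)) ?_ ht₀ ?_ ht
  · intro t ht i j
    have := hasDerivAt_mul_apply (t := t) (B' := 0) (hR t ht).2
      (fun i j => hasDerivAt_const t (((R t₀)⁻¹ * R' t₀) i j)) i j
    rwa [Matrix.mul_zero, add_zero, Matrix.mul_assoc] at this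
  · rw [← Matrix.mul_assoc, Matrix.mul_nonsing_inv _ (isUnit_det_of_mem_affSp h0), Matrix.one_mul]

/-- A matrix solution with value 1 at t₀ stays in the group because the conditions on M place it in
the Lie algebra: along the solution the first row and ᵗAJA have zero derivative. -/
theorem exists_hasMCForm (hI : IsOpen I) (hIc : I.OrdConnected)
    (hM : ∀ i j, ContinuousOn (fun t => M t i j) I) (hM0 : ∀ t ∈ I, M t 0 = 0)
    (hMJ : ∀ t ∈ I, (linPart (M t))ᵀ * sympJ + sympJ * linPart (M t) = 0) :
    ∃ R, HasMCForm I M R := by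
  rcases I.eq_empty_or_nonempty with rfl | ⟨t₀, ht₀⟩
  · exact ⟨fun _ => 1, fun t ht => ht.elim⟩
  obtain ⟨R, hR0, hR⟩ := exists_matrix_ode (M := fun t => -(M t)) hI hIc
    (fun i j => (hM i j).neg) ht₀
  have hconst : ∀ f : ℝ → ℝ, (∀ t ∈ I, HasDerivAt f 0 t) → ∀ t ∈ I, f t = f t₀ := fun f hf t ht =>
    hI.is_const_of_deriv_eq_zero hIc.isPreconnected
      (fun s hs => (hf s hs).differentiableAt.differentiableWithinAt)
      (fun s hs => (hf s hs).deriv) ht ht₀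
  have hrow : ∀ t ∈ I, R t 0 = Pi.single 0 1 := by
    intro t ht
    rw [← one_mem_affSp.1, ← hR0]
    funext j
    refine hconst (fun t => R t 0 j) (fun s hs => (hR s hs 0 j).congr_deriv ?_) t ht
    rw [Matrix.mul_apply]
    exact Finset.sum_eq_zero fun b _ => by
      rw [Matrix.neg_apply, hM0 s hs, Pi.zero_apply, neg_zero, zero_mul]
  refine ⟨R, fun t ht => ⟨⟨hrow t ht, ?_⟩, hR t ht⟩⟩
  have hL : ∀ s ∈ I, ∀ i j, HasDerivAt (fun s => linPart (R s) i j)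
      ((-(linPart (M s)) * linPart (R s)) i j) s := by
    intro s hs i j
    refine (hR s hs i.succ j.succ).congr_deriv ?_
    change linPart (-(M s) * R s) i j = _
    rw [linPart_mul (hrow s hs)]
    rfl
  have hgram : (linPart (R t₀))ᵀ * sympJ * linPart (R t₀) = sympJ := by
    rw [hR0]
    exact one_mem_affSp.2
  ext i j
  rw [← congrFun (congrFun hgram i) j]
  refine hconst (fun t => ((linPart (R t))ᵀ * sympJ * linPart (R t)) i j) (fun s hs => ?_) t ht
  have h1 := hasDerivAt_mul_apply (t := s) (A := fun s => (linPart (R s))ᵀ) (B := fun _ => sympJ)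
    (A' := (-(linPart (M s)) * linPart (R s))ᵀ) (B' := 0)
    (fun i j => hL s hs j i) (fun i j => hasDerivAt_const _ _)
  refine (hasDerivAt_mul_apply h1 (hL s hs) i j).congr_deriv ?_
  have : (-(linPart (M s)) * linPart (R s))ᵀ * sympJ * linPart (R s) +
      (linPart (R s))ᵀ * sympJ * (-(linPart (M s)) * linPart (R s)) =
      -((linPart (R s))ᵀ * ((linPart (M s))ᵀ * sympJ + sympJ * linPart (M s)) * linPart (R s)) := by
    simp only [Matrix.transpose_mul, Matrix.transpose_neg, Matrix.mul_add, Matrix.add_mul,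
      Matrix.mul_neg, Matrix.neg_mul, Matrix.mul_assoc]
    abel
  rw [Matrix.mul_zero, add_zero, this, hMJ s hs]
  simp

end MCForm

theorem frenetVal_hamiltonian (k1 dk1 k2 k3 τ : ℝ) :
    (linPart (frenetVal k1 dk1 k2 k3 τ))ᵀ * sympJ + sympJ * linPart (frenetVal k1 dk1 k2 k3 τ) =
      0 := by
  have h : linPart (frenetVal k1 dk1 k2 k3 τ) =
    !![0, k1 * τ, -τ, dk1 * τ / k2;
       1, -(k1 * dk1 * τ / k2), dk1 * τ / k2, -((dk1 ^ 2 * τ + k3) / k2 ^ 2);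
       k1, 0, 0, -1;
       0, k2 + k1 ^ 2 * τ, -(k1 * τ), k1 * dk1 * τ / k2] := by
    ext i j
    fin_cases i <;> fin_cases j <;> rfl
  rw [h]
  ext i j
  fin_cases i <;> fin_cases j <;> simp [sympJ, Matrix.mul_apply, Fin.sum_univ_four]

/-! ### Congruence -/

section Congruence

variable {I : Set ℝ}

theorem iteratedDeriv_affAct (hI : IsOpen I) {γ₁ γ₂ : ℝ → Fin 4 → ℝ} (h₁ : ContDiffOn ℝ ∞ γ₁ I)
    {g : Matrix (Fin 5) (Fin 5) ℝ} (h : ∀ t ∈ I, γ₂ t = affAct g (γ₁ t)) (n : ℕ) :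
    ∀ t ∈ I, iteratedDeriv (n + 1) γ₂ t = linPart g *ᵥ iteratedDeriv (n + 1) γ₁ t := by
  have hL : ∀ n, ∀ t ∈ I, HasDerivAt (fun s => linPart g *ᵥ iteratedDeriv n γ₁ s)
      (linPart g *ᵥ iteratedDeriv (n + 1) γ₁ t) t := fun n t ht =>
    (LinearMap.toContinuousLinearMap (linPart g).mulVecLin).hasFDerivAt.comp_hasDerivAt t
      (hasDerivAt_iteratedDeriv hI h₁ n ht)
  induction n with
  | zero =>
    intro t ht
    -- The translation part is a constant summand, so it disappears with the first derivative.
    have haff : ∀ x, affAct g x = linPart g *ᵥ x + fun a => g a.succ 0 := fun x => by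
      funext a
      simp [affAct, linPart, mulVec, dotProduct, Fin.sum_univ_succ (n := 4)]
      ring
    rw [iteratedDeriv_succ, iteratedDeriv_zero]
    refine HasDerivAt.deriv (((hL 0 t ht).add_const (fun a => g a.succ 0)).congr_of_eventuallyEq ?_)
    filter_upwards [hI.mem_nhds ht] with s hs
    rw [h s hs, haff, iteratedDeriv_zero]
  | succ n ih =>
    intro t ht
    rw [iteratedDeriv_succ]
    refine HasDerivAt.deriv ((hL (n + 1) t ht).congr_of_eventuallyEq ?_)
    filter_upwards [hI.mem_nhds ht] with s hs using ih s hs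

theorem curveCurv_affAct (hI : IsOpen I) {γ₁ γ₂ : ℝ → Fin 4 → ℝ} (h₁ : ContDiffOn ℝ ∞ γ₁ I)
    {g : Matrix (Fin 5) (Fin 5) ℝ} (hg : g ∈ affSp) (h : ∀ t ∈ I, γ₂ t = affAct g (γ₁ t)) (n : ℕ)
    {t : ℝ} (ht : t ∈ I) : curveCurv (n + 1) γ₂ t = curveCurv (n + 1) γ₁ t := by
  change sympForm (iteratedDeriv (n + 1) γ₂ t) (iteratedDeriv (n + 2) γ₂ t) = _
  rw [iteratedDeriv_affAct hI h₁ h n t ht, iteratedDeriv_affAct hI h₁ h (n + 1) t ht,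
    sympForm_mulVec hg.2]
  rfl

theorem phiOf_congr (hI : IsOpen I) {k1 k2 k3 l1 l2 l3 : ℝ → ℝ} (h1 : EqOn k1 l1 I)
    (h2 : EqOn k2 l2 I) (h3 : EqOn k3 l3 I) : EqOn (phiOf k1 k2 k3) (phiOf l1 l2 l3) I := by
  intro t ht
  rw [phiOf, phiOf, h1 ht, h2 ht, h3 ht, eqOn_deriv hI h1 ht, eqOn_deriv hI h2 ht,
    eqOn_deriv hI (eqOn_deriv hI h1) ht]

theorem normOf_congr (hI : IsOpen I) {k1 k2 k3 l1 l2 l3 : ℝ → ℝ} (h1 : EqOn k1 l1 I)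
    (h2 : EqOn k2 l2 I) (h3 : EqOn k3 l3 I) : EqOn (normOf k1 k2 k3) (normOf l1 l2 l3) I := by
  intro t ht
  rw [normOf, normOf, h1 ht, h2 ht, h3 ht, eqOn_deriv hI h1 ht, eqOn_deriv hI h2 ht,
    eqOn_deriv hI (eqOn_deriv hI h1) ht]

theorem frenetOf_congr (hI : IsOpen I) {k1 k2 k3 k4 l1 l2 l3 l4 : ℝ → ℝ} (h1 : EqOn k1 l1 I)
    (h2 : EqOn k2 l2 I) (h3 : EqOn k3 l3 I) (h4 : EqOn k4 l4 I) :
    EqOn (frenetOf k1 k2 k3 k4) (frenetOf l1 l2 l3 l4) I := by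
  intro t ht
  rw [frenetOf, frenetOf, tauOf, tauOf, phiOf_congr hI h1 h2 h3 ht, h1 ht, h2 ht, h3 ht, h4 ht,
    eqOn_deriv hI h1 ht, eqOn_deriv hI h2 ht, eqOn_deriv hI h3 ht,
    eqOn_deriv hI (eqOn_deriv hI h2) ht]

theorem HasMCForm.congr {M N R : ℝ → Matrix (Fin 5) (Fin 5) ℝ} (hMN : EqOn M N I)
    (h : HasMCForm I M R) : HasMCForm I N R := fun t ht => by
  rw [← hMN ht]
  exact h t ht

theorem exists_affAct_of_curveCurv_eq (hI : IsOpen I) (hIc : I.OrdConnected)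
    {γ₁ γ₂ : ℝ → Fin 4 → ℝ} (h₁ : ContDiffOn ℝ ∞ γ₁ I) (h₂ : ContDiffOn ℝ ∞ γ₂ I)
    (hreg : ∀ t ∈ I, jet 4 γ₁ t ∈ regJets)
    (h : ∀ i ∈ Finset.Icc 1 4, EqOn (curveCurv i γ₂) (curveCurv i γ₁) I) :
    ∃ g ∈ affSp, ∀ t ∈ I, γ₂ t = affAct g (γ₁ t) := by
  have e1 := h 1 (by decide)
  have e2 := h 2 (by decide)
  have e3 := h 3 (by decide)
  have e4 := h 4 (by decide)
  -- κ₂ and φ are functions of the curvatures and their derivatives, so `γ₂` inherits regularity.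
  have hreg₂ : ∀ t ∈ I, jet 4 γ₂ t ∈ regJets := fun t ht => by
    rw [mem_regJets_jet hI h₂ ht, e2 ht, phiOf_congr hI e1 e2 e3 ht, ← mem_regJets_jet hI h₁ ht]
    exact hreg t ht
  have hR₁ := hasMCForm_frame_jet hI h₁ hreg
  have hR₂ := (hasMCForm_frame_jet hI h₂ hreg₂).congr (frenetOf_congr hI e1 e2 e3 e4)
  obtain ⟨g, hg, hRg⟩ := exists_eq_mul_of_hasMCForm hIc (fun i j => (contDiffOn_frenetOf hI
    (contDiffOn_curveCurv hI h₁ 1) (contDiffOn_curveCurv hI h₁ 2) (contDiffOn_curveCurv hI h₁ 3)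
    (contDiffOn_curveCurv hI h₁ 4) (fun t ht => ((mem_regJets_jet hI h₁ ht).1 (hreg t ht)).1)
    (fun t ht => ((mem_regJets_jet hI h₁ ht).1 (hreg t ht)).2) i j).continuousOn) hR₂ hR₁
  refine ⟨g, hg, fun t ht => ?_⟩
  -- The jets have the same normal form and their frames differ by `g`; cancelling the frame of `γ₂`
  -- leaves g ⋆ j⁴γ₁ = j⁴γ₂, whose order zero part is the claim.
  have hn : normJet (jet 4 γ₁ t) = normJet (jet 4 γ₂ t) := by
    rw [normJet_jet hI h₁ ht, normJet_jet hI h₂ ht, normOf_congr hI e1 e2 e3 ht]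
  rw [← act_frame (hreg t ht), ← act_frame (hreg₂ t ht), hRg t ht, ← act_act _ hg.1] at hn
  have hF := frame_mem_affSp (hreg₂ t ht)
  have hj := congrArg (act (frame (jet 4 γ₂ t))⁻¹) hn
  rw [act_inv_act hF, act_inv_act hF] at hj
  have h0 := (act_zero g (jet 4 γ₁ t)).symm.trans (congrFun (congrArg Prod.snd hj) 0)
  simpa [jet] using h0.symm

end Congruence

/-! ### Realization -/

section Realization

variable {I : Set ℝ}

/-- Bootstrapping: if R is of class Cⁿ, then so is R' = -M R, hence R is of class Cⁿ⁺¹. -/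
theorem contDiffOn_of_hasMCForm (hI : IsOpen I) {M R : ℝ → Matrix (Fin 5) (Fin 5) ℝ}
    (hM : ∀ i j, ContDiffOn ℝ ∞ (fun t => M t i j) I) (hR : HasMCForm I M R) (i j : Fin 5) :
    ContDiffOn ℝ ∞ (fun t => R t i j) I := by
  have hd : ∀ i j, DifferentiableOn ℝ (fun t => R t i j) I := fun i j t ht =>
    ((hR t ht).2 i j).differentiableAt.differentiableWithinAt
  suffices h : ∀ n : ℕ, ∀ i j, ContDiffOn ℝ n (fun t => R t i j) I from
    contDiffOn_infty.2 fun n => h n i j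
  intro n
  induction n with
  | zero => exact fun i j => contDiffOn_zero.2 (hd i j).continuousOn
  | succ n ih =>
    intro i j
    rw [Nat.cast_add, Nat.cast_one, contDiffOn_succ_iff_deriv_of_isOpen hI]
    refine ⟨hd i j, fun h => by simp at h, ?_⟩
    have h1 : ContDiffOn ℝ n (fun t => (-(M t) * R t) i j) I :=
      contDiffOn_mul_apply (A := fun t => -(M t))
        (fun i j => ((hM i j).of_le (mod_cast le_top)).neg) ih i j
    exact h1.congr fun t ht => ((hR t ht).2 i j).deriv

theorem HasMCForm.hasDerivAt_inv (hI : IsOpen I) {M R : ℝ → Matrix (Fin 5) (Fin 5) ℝ}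
    (hRd : ∀ i j, ContDiffOn ℝ ∞ (fun t => (R t)⁻¹ i j) I) (hR : HasMCForm I M R) {t : ℝ}
    (ht : t ∈ I) (i j : Fin 5) :
    HasDerivAt (fun s => (R s)⁻¹ i j) (((R t)⁻¹ * M t) i j) t := by
  have hQ : ∀ i j, HasDerivAt (fun s => (R s)⁻¹ i j)
      ((Matrix.of fun i j => deriv (fun s => (R s)⁻¹ i j) t) i j) t := fun i j =>
    (((hRd i j).contDiffAt (hI.mem_nhds ht)).differentiableAt (by simp)).hasDerivAt
  set Q' : Matrix (Fin 5) (Fin 5) ℝ := Matrix.of fun i j => deriv (fun s => (R s)⁻¹ i j) t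
  have hu : ∀ s ∈ I, IsUnit (R s).det := fun s hs => isUnit_det_of_mem_affSp (hR s hs).1
  have h0 : -(M t) * R t * (R t)⁻¹ + R t * Q' = 0 := by
    ext i j
    refine (hasDerivAt_mul_apply (hR t ht).2 hQ i j).unique ?_
    refine (hasDerivAt_const t ((1 : Matrix (Fin 5) (Fin 5) ℝ) i j)).congr_of_eventuallyEq ?_
    filter_upwards [hI.mem_nhds ht] with s hs
    rw [Matrix.mul_nonsing_inv _ (hu s hs)]
  have h1 : Q' = (R t)⁻¹ * M t := by
    rw [Matrix.mul_assoc, Matrix.mul_nonsing_inv _ (hu t ht), Matrix.mul_one,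
      neg_add_eq_zero] at h0
    rw [h0, ← Matrix.mul_assoc, Matrix.nonsing_inv_mul _ (hu t ht), Matrix.one_mul]
  rw [← h1]
  exact hQ i j

variable {k1 k2 k3 k4 : ℝ → ℝ}

theorem normOf_mem_crossSec (h0 : ∀ t ∈ I, k2 t ≠ 0) (hφ : ∀ t ∈ I, phiOf k1 k2 k3 t ≠ 0) {t : ℝ}
    (ht : t ∈ I) : normOf k1 k2 k3 t ∈ crossSec :=
  normVal_mem_crossSec _ _ _ _ _ _ (h0 t ht) (hφ t ht)

theorem exists_curve_of_hasMCForm (hI : IsOpen I)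
    (h1 : ContDiffOn ℝ ∞ k1 I) (h2 : ContDiffOn ℝ ∞ k2 I)
    (h3 : ContDiffOn ℝ ∞ k3 I) (h4 : ContDiffOn ℝ ∞ k4 I) (h0 : ∀ t ∈ I, k2 t ≠ 0)
    (hφ : ∀ t ∈ I, phiOf k1 k2 k3 t ≠ 0) {R : ℝ → Matrix (Fin 5) (Fin 5) ℝ}
    (hR : HasMCForm I (frenetOf k1 k2 k3 k4) R) :
    ∃ γ : ℝ → Fin 4 → ℝ, ContDiffOn ℝ ∞ γ I ∧
      ∀ t ∈ I, jet 4 γ t = act (R t)⁻¹ (normOf k1 k2 k3 t) ∧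
        curveCurv 1 γ t = k1 t ∧ curveCurv 2 γ t = k2 t ∧
        curveCurv 3 γ t = k3 t ∧ curveCurv 4 γ t = k4 t := by
  have hRs := contDiffOn_of_hasMCForm hI (contDiffOn_frenetOf hI h1 h2 h3 h4 h0 hφ) hR
  have hQs : ∀ i j, ContDiffOn ℝ ∞ (fun t => (R t)⁻¹ i j) I := contDiffOn_inv_apply hRs
    fun t ht => (isUnit_det_of_mem_affSp (hR t ht).1).ne_zero
  have hQ : ∀ t ∈ I, (R t)⁻¹ ∈ affSp := fun t ht => inv_mem_affSp (hR t ht).1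
  have hd : ∀ {f : ℝ → ℝ}, ContDiffOn ℝ ∞ f I → ∀ {t : ℝ}, t ∈ I →
      HasDerivAt f (1 * deriv f t) t := fun hf t ht => by
    rw [one_mul]
    exact ((hf.contDiffAt (hI.mem_nhds ht)).differentiableAt (by simp)).hasDerivAt
  have d1 := contDiffOn_deriv hI h1
  have dd1 := contDiffOn_deriv hI d1
  have d2 := contDiffOn_deriv hI h2
  let N : ℝ → Matrix (Fin 5) (Fin 5) ℝ := fun t => normMatShift (k1 t) (deriv k1 t)
    (deriv (deriv k1) t) (deriv (deriv (deriv k1)) t) (k2 t) (deriv k2 t) (deriv (deriv k2) t)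
    (k3 t) (deriv k3 t) (tauOf k1 k2 k3 k4 t)
  let n5 : ℝ → Fin 4 → ℝ := fun t => normNext (k1 t) (deriv k1 t)
    (deriv (deriv k1) t) (deriv (deriv (deriv k1)) t) (k2 t) (deriv k2 t) (deriv (deriv k2) t)
    (k3 t) (deriv k3 t) (tauOf k1 k2 k3 k4 t)
  -- Since (R⁻¹)' = R⁻¹M, the derivative of R⁻¹N is R⁻¹(M N + N') = R⁻¹S. Column i of S is column i
  -- + 1 of N except in row zero and in the last column, which makes each column of R⁻¹N the
  -- derivative of the preceding one.
  have hW : ∀ t ∈ I, ∀ i j, HasDerivAt (fun s => ((R s)⁻¹ * jetMatrix (normOf k1 k2 k3 s)) i j)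
      (((R t)⁻¹ * N t) i j) t := by
    intro t ht i j
    refine (hasDerivAt_mul_apply (hR.hasDerivAt_inv hI hQs ht)
      (hasDerivAt_normVal (h0 t ht) (hd h1 ht) (hd d1 ht) (hd dd1 ht) (hd h2 ht) (hd d2 ht)
        (hd h3 ht) fun s => s) i j).congr_deriv ?_
    rw [Matrix.mul_assoc, ← Matrix.mul_add, one_smul, frenetOf,
      frenetVal_mul_normVal _ _ _ _ (deriv (deriv (deriv k1)) t) _ (deriv (deriv k2) t) _
        (deriv k3 t) _ (h0 t ht), sub_add_cancel]
  let Y : ℝ → Fin 5 → Fin 4 → ℝ := fun t => (act (R t)⁻¹ (normOf k1 k2 k3 t)).2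
  have hYd : ∀ t ∈ I, ∀ i : Fin 4, HasDerivAt (fun s => Y s i.castSucc) (Y t i.succ) t := by
    intro t ht i
    refine hasDerivAt_pi.2 fun a => (hW t ht a.succ i.castSucc).congr_deriv ?_
    change _ = ((R t)⁻¹ * jetMatrix (normOf k1 k2 k3 t)) a.succ i.succ
    rw [Matrix.mul_apply, Matrix.mul_apply]
    refine Finset.sum_congr rfl fun b _ => congrArg _ ?_
    refine Fin.cases ?_ (fun b => ?_) b
    · simp [N, normMatShift, jetMatrix]
    · simp only [N, normMatShift, Matrix.of_apply, Fin.cons_succ, Fin.snoc_castSucc]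
      rfl
  have hY5 : ∀ t ∈ I, HasDerivAt (fun s => Y s 4) (linPart (R t)⁻¹ *ᵥ n5 t) t := by
    intro t ht
    refine hasDerivAt_pi.2 fun a => (hW t ht a.succ 4).congr_deriv ?_
    rw [Matrix.mul_apply, Fin.sum_univ_succ]
    have hN0 : N t 0 4 = 0 := rfl
    have hNs : ∀ b : Fin 4, N t b.succ 4 = n5 t b := fun b => by
      change N t b.succ (Fin.last 4) = _
      simp only [N, n5, normMatShift, Matrix.of_apply, Fin.cons_succ, Fin.snoc_last]
    simp only [hN0, hNs, mul_zero, zero_add]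
    rfl
  let γ : ℝ → Fin 4 → ℝ := fun t => Y t 0
  have hγ : ∀ i : Fin 5, ∀ t ∈ I, iteratedDeriv i γ t = Y t i := by
    intro i
    induction i using Fin.induction with
    | zero => exact fun t _ => by simp [γ]
    | succ i ih =>
      intro t ht
      rw [Fin.val_succ, iteratedDeriv_succ]
      refine HasDerivAt.deriv ((hYd t ht i).congr_of_eventuallyEq ?_)
      filter_upwards [hI.mem_nhds ht] with s hs using ih s hs
  have hγ5 : ∀ t ∈ I, iteratedDeriv 5 γ t = linPart (R t)⁻¹ *ᵥ n5 t := by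
    intro t ht
    rw [iteratedDeriv_succ]
    refine HasDerivAt.deriv ((hY5 t ht).congr_of_eventuallyEq ?_)
    filter_upwards [hI.mem_nhds ht] with s hs using hγ 4 s hs
  refine ⟨γ, contDiffOn_pi.2 fun a => ?_, fun t ht => ?_⟩
  -- The normal form has X⁽⁰⁾ = 0, so γ is the translation part of R⁻¹ and inherits its smoothness.
  · refine (hQs a.succ 0).congr fun t _ => ?_
    change (act (R t)⁻¹ (normOf k1 k2 k3 t)).2 0 a = _
    rw [act_zero]
    have : (normOf k1 k2 k3 t).2 0 = 0 := by
      funext a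
      fin_cases a <;> rfl
    simp [this, affAct, mulVec, dotProduct, Fin.sum_univ_succ (n := 4)]
  · have hjet : jet 4 γ t = act (R t)⁻¹ (normOf k1 k2 k3 t) :=
      Prod.ext rfl (funext fun i => hγ i t ht)
    have hcurv : ∀ i : Fin 3, curveCurv (i + 1) γ t = sympForm
        ((normOf k1 k2 k3 t).2 i.castSucc.succ) ((normOf k1 k2 k3 t).2 i.succ.succ) := by
      intro i
      rw [← sympForm_act (hQ t ht), ← hjet]
      rfl
    obtain ⟨h12, -, -, h23, -, h34⟩ := sympForm_normVal (k1 t) (deriv k1 t) (deriv (deriv k1) t)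
      (deriv k2 t) (k3 t) (h0 t ht) _ rfl
    -- The first three curvatures are products of the normal form. The fourth involves the fifth
    -- derivative, which the 4-jet does not contain; it comes from the derivative of the last
    -- column.
    refine ⟨hjet, (hcurv 0).trans h12, (hcurv 1).trans h23, (hcurv 2).trans h34, ?_⟩
    change sympForm (iteratedDeriv 4 γ t) (iteratedDeriv 5 γ t) = _
    have h4' : iteratedDeriv 4 γ t = linPart (R t)⁻¹ *ᵥ (normOf k1 k2 k3 t).2 4 :=
      (hγ 4 t ht).trans (act_succ _ _ 3)
    rw [h4', hγ5 t ht, sympForm_mulVec (hQ t ht).2]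
    exact sympForm_normNext (h0 t ht) (hφ t ht)

end Realization

end

theorem mainTheorem4 :
    -- the 14 equations: codimension 14, and transversality to the orbits
    (∀ z ∈ secVariety,
      Function.Surjective (fderiv ℝ secMap z) ∧
      excluded z = curv 2 (trunc 3 z) * phi z ∧
      (transMatrix z).det = -excluded z ∧
      (IsCompl (LinearMap.ker (fderiv ℝ secMap z).toLinearMap) (orbitTangent z) ↔
        excluded z ≠ 0)) ∧
    -- they define a cross-section of minimal order
    IsMinimalOrderCrossSection crossSec ∧
    -- the expression of `φ` in terms of the symplectic curvatures
    (∀ z : Jet 4, phi z = phiJet z) ∧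
    -- jets of linearly full (equivalently, non-degenerate) Lagrangian curves are covered
    (∀ (I : Set ℝ) (γ : ℝ → Fin 4 → ℝ), IsOpen I → I.OrdConnected → IsLagrangian I γ →
      (IsLinearlyFull I γ ↔ ∀ t ∈ I, jet 4 γ t ∈ regJets) ∧
      ((∀ t ∈ I, curveCurv 2 γ t ≠ 0) ↔ ∀ t ∈ I, jet 4 γ t ∈ regJets)) ∧
    -- the moving frame
    (∃ ρ : Jet 4 → Matrix (Fin 5) (Fin 5) ℝ, IsMovingFrame ρ ∧
      -- it is the only one, and it is the identity on the cross-section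
      (∀ z ∈ regJets, ∀ g ∈ affSp, act g z ∈ crossSec → g = ρ z) ∧
      (∀ z ∈ crossSec, ρ z = 1) ∧
      -- normalized invariants, and explicit form of the frame
      (∀ z ∈ regJets,
        act (ρ z) z = normJet z ∧
        ρ z = jetMatrix (normJet z) * (jetMatrix z)⁻¹ ∧
        curv 1 (trunc 2 z) = (act (ρ z) z).2 2 2 ∧
        curv 2 (trunc 3 z) = (act (ρ z) z).2 3 3 ∧
        curv 3 z = -((act (ρ z) z).2 3 3 * (act (ρ z) z).2 4 1) ∧
        (transMatrix (act (ρ z) z)).det = -(curv 2 (trunc 3 z) * phi z)) ∧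
      -- the invariant `τ` and the Maurer–Cartan matrix, modulo contact forms
      (∀ z : Jet 5, trunc 4 z ∈ regJets →
        (act (ρ (trunc 4 z)) z).2 3 3 * (act (ρ (trunc 4 z)) z).2 5 0 / phi (trunc 4 z)
          = tauJet z ∧
        ∀ v : Jet 5, IsContactVector z v → pullbackMC ρ z v = -(v.1 • frenetJet z)) ∧
      -- the same along curves
      (∀ (I : Set ℝ) (γ : ℝ → Fin 4 → ℝ), IsOpen I → I.OrdConnected → ContDiffOn ℝ ∞ γ I →
        (∀ t ∈ I, jet 4 γ t ∈ regJets) →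
        (∀ t ∈ I, act (ρ (jet 4 γ t)) (jet 4 γ t) =
          normOf (curveCurv 1 γ) (curveCurv 2 γ) (curveCurv 3 γ) t) ∧
        HasMCForm I
          (frenetOf (curveCurv 1 γ) (curveCurv 2 γ) (curveCurv 3 γ) (curveCurv 4 γ))
          (fun t => ρ (jet 4 γ t)))) ∧
    -- congruence of curves
    (∀ (I : Set ℝ) (γ₁ γ₂ : ℝ → Fin 4 → ℝ), IsOpen I → I.OrdConnected →
      ContDiffOn ℝ ∞ γ₁ I → ContDiffOn ℝ ∞ γ₂ I → (∀ t ∈ I, jet 4 γ₁ t ∈ regJets) →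
      ((∃ g ∈ affSp, ∀ t ∈ I, γ₂ t = affAct g (γ₁ t)) ↔
        ∀ i ∈ Finset.Icc 1 4, ∀ t ∈ I, curveCurv i γ₂ t = curveCurv i γ₁ t)) ∧
    -- realization of arbitrary data
    (∀ (I : Set ℝ) (k1 k2 k3 k4 : ℝ → ℝ), IsOpen I → I.OrdConnected →
      ContDiffOn ℝ ∞ k1 I → ContDiffOn ℝ ∞ k2 I → ContDiffOn ℝ ∞ k3 I → ContDiffOn ℝ ∞ k4 I →
      (∀ t ∈ I, k2 t ≠ 0) → (∀ t ∈ I, phiOf k1 k2 k3 t ≠ 0) →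
      (∀ t ∈ I, normOf k1 k2 k3 t ∈ crossSec) ∧
      (∃ R, HasMCForm I (frenetOf k1 k2 k3 k4) R) ∧
      (∀ R R', HasMCForm I (frenetOf k1 k2 k3 k4) R → HasMCForm I (frenetOf k1 k2 k3 k4) R' →
        ∃ g ∈ affSp, ∀ t ∈ I, R' t = R t * g) ∧
      (∀ R, HasMCForm I (frenetOf k1 k2 k3 k4) R →
        ∃ γ : ℝ → Fin 4 → ℝ, ContDiffOn ℝ ∞ γ I ∧
          ∀ t ∈ I, jet 4 γ t = act (R t)⁻¹ (normOf k1 k2 k3 t) ∧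
            curveCurv 1 γ t = k1 t ∧ curveCurv 2 γ t = k2 t ∧
            curveCurv 3 γ t = k3 t ∧ curveCurv 4 γ t = k4 t)) := by
  refine ⟨fun z hz => ⟨surjective_fderiv_secMap z, excluded_eq hz, det_transMatrix hz,
      isCompl_iff_excluded_ne_zero hz⟩, isMinimalOrderCrossSection_crossSec, phi_eq_phiJet,
    fun I γ hI _ hγ => ⟨hγ.isLinearlyFull_iff hI,
      forall₂_congr fun t ht => (hγ.mem_regJets_iff hI ht).symm⟩,
    ⟨frame, isMovingFrame_frame, fun z hz g hg h => eq_frame hz hg h,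
      fun z hz => frame_of_mem_crossSec hz, fun z hz => ?_,
      fun z hz => ⟨tau_eq hz, fun v hv => pullbackMC_frame hz hv⟩,
      fun I γ hI _ hγ hreg => ⟨fun t ht => (act_frame (hreg t ht)).trans (normJet_jet hI hγ ht),
        hasMCForm_frame_jet hI hγ hreg⟩⟩,
    fun I γ₁ γ₂ hI hIc h₁ h₂ hreg => ⟨?_, exists_affAct_of_curveCurv_eq hI hIc h₁ h₂ hreg⟩,
    fun I k1 k2 k3 k4 hI hIc h1 h2 h3 h4 h0 hφ => ?_⟩
  · have hF := frame_mem_affSp hz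
    have hS := normJet_mem_crossSec hz
    refine ⟨act_frame hz, rfl, ?_, ?_, ?_, ?_⟩
    · rw [act_frame hz]
      rfl
    · rw [act_frame hz]
      rfl
    · rw [act_frame hz]
      change curv 3 z = -(curv 2 (trunc 3 z) * -(curv 3 z / curv 2 (trunc 3 z)))
      rw [mul_neg, neg_neg]
      exact (mul_div_cancel₀ (b := curv 2 (trunc 3 z)) _ (mem_regJets.1 hz).1).symm
    · rw [← act_frame hz] at hS
      rw [det_transMatrix hS.1, excluded_eq hS.1, phi_act hF]
      exact congrArg (fun x => -(x * phi z)) (sympForm_act hF z 1 2)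
  · rintro ⟨g, hg, h⟩ i hi t ht
    obtain ⟨n, rfl⟩ := Nat.exists_eq_add_of_le' (Finset.mem_Icc.1 hi).1
    exact curveCurv_affAct hI h₁ hg h n ht
  · have hM := fun i j => (contDiffOn_frenetOf hI h1 h2 h3 h4 h0 hφ i j).continuousOn
    refine ⟨fun t ht => normOf_mem_crossSec h0 hφ ht, ?_,
      fun R R' hR hR' => exists_eq_mul_of_hasMCForm hIc hM hR hR',
      fun R hR => exists_curve_of_hasMCForm hI h1 h2 h3 h4 h0 hφ hR⟩
    refine exists_hasMCForm hI hIc hM (fun t _ => ?_) fun t _ => frenetVal_hamiltonian _ _ _ _ _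
    funext j
    fin_cases j <;> rfl
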